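/- **Setting.** Let $n\ge 0$ and let $q>0$ be real. A (noncrossing) half-diagram $\mathfrak a$ on the points $1,\dots,n$ is a partition of the points into pairs (arches) and single points (through-strings) such that there are no $i<k<j<l$ with $\{i,j\},\{k,l\}$ paired, and no $i<k<j$ with $\{i,j\}$ paired and $k$ a through-string. $U(n)$ is the complex vector space with basis $\xi_{\mathfrak a}$, $\mathfrak a$ running over the half-diagrams on $n$ points. It carries the form, linear in the first and conjugate linear in the second variable, defined as follows: identify equal points of $\mathfrak a$ and $\mathfrak b$; if some edge path joins two different through-strings of the same diagram, then $\langle\xi_{\mathfrak a},\xi_{\mathfrak b}\rangle=0$; otherwise $\langle\xi_{\mathfrak a},\xi_{\mathfrak b}\rangle=q^c$, where $c$ is the number of closed loops. A noncrossing pairing $\mathfrak p$ of $\{1,\dots,2n\}$ acts on $U(n)$ by concatenation: identify point $2n-j+1$ of $\mathfrak p$ with point $j$ of $\mathfrak a$ for $1\le j\le n$; if an edge path joins two different through-strings of $\mathfrak a$, the result is $0$; otherwise it is $q^c\xi_{\mathfrak b}$, where $c$ is the number of closed loops and $\mathfrak b$ is the half-diagram left on the points $1,\dots,n$ of $\mathfrak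 p$. For $1\le i\le n-1$, $e_i$ denotes the action of the pairing $\{i,i+1\},\{2n-i+1,2n-i\},\{j,2n-j+1\}$ ($j\le n$, $j\ne i,i+1$). The $j$th bracket of $\mathfrak a$ is closing if $j$ is paired with a smaller point, and opening otherwise; $h_i(\mathfrak a)$ is the number of opening minus the number of closing brackets among the first $i$. The restricted sequence $(a_1,\dots,a_m)$ of $\mathfrak a$ is empty if $\mathfrak a$ has no arch; otherwise $a_1$ is the least number such that $\{a_1,a_1+1\}$ is an arch of $\mathfrak a$, and $(a_2,\dots,a_m)$ is the restricted sequence of the half-diagram on $n-2$ points obtained by removing this arch and its two points. If the $i$th bracket of $\mathfrak a$ is closing and the $(i+1)$th is opening ($\mathfrak a$ has a minimum at $i$), then $\Diamond_i(\mathfrak a)$ is the half-diagram whose bracket sequence is that of $\mathfrak a$ with these two brackets interchanged. Let $\Delta_{-1}=0$ and, for $k\ge 0$, let $\Delta_k=\Delta_k(q)$ be the determinant of the $k\times k$ matrix with diagonal entries $q$, entries $1$ directly above and below the diagonal, and $0$ elsewhere. Put $\mu_k=\Delta_{k-1}/\Delta_k$. The vectors $\xi'_{\mathfrak a}\in U(n)$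 are defined by $\xi'_{\mathfrak a}=\xi_{\mathfrak a}$ if the restricted sequence of $\mathfrak a$ is $(1,\dots,1)$ (possibly empty), and $\xi'_{\Diamond_i(\mathfrak a)}=(e_i-\mu_{h_i(\mathfrak a)+1})\,\xi'_{\mathfrak a}$ whenever $\mathfrak a$ has a minimum at $i$. **Theorem.** Let $\mathfrak a$ be a half-diagram on $n$ points with restricted sequence $(a_1,\dots,a_m)$, and suppose that $\Delta_k(q)\neq 0$ for all $k$ with $1\le k\le\max_j a_j$. Then $\xi'_{\mathfrak a}$ is well defined (these rules give $\mathfrak a$ exactly one vector, independently of the chosen sequence of box additions), and $$\langle\xi'_{\mathfrak a},\xi'_{\mathfrak a}\rangle=\frac{1}{\mu_{a_1}\cdots\mu_{a_m}}.$$ -/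

import Mathlib

open scoped ComplexConjugate

namespace TemperleyLieb

/-- A noncrossing half-diagram on `n` points. The points `1, …, n` are the elements of `Fin n`
(point `j` is the element with value `j - 1`). `partner j = j` means that `j` carries a
through-string; otherwise `j` is paired with `partner j`. -/
@[ext]
structure HalfDiagram (n : ℕ) where
  partner : Fin n → Fin n
  partner_partner : ∀ i, partner (partner i) = i
  noncrossing : ∀ i k, ¬ (i < k ∧ k < partner i ∧ partner i < partner k)
  noncrossing_through : ∀ i k, ¬ (i < k ∧ k < partner i ∧ partner k = k)

/-- A noncrossing pairing of `2n` points (a basis diagram of `TL_n`): a half-diagram on `2n`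
points without through-strings. -/
structure Pairing (n : ℕ) extends HalfDiagram (2 * n) where
  no_through : ∀ i, partner i ≠ i

/-- The space `U(n)` of formal complex linear combinations of noncrossing half-diagrams. -/
abbrev U (n : ℕ) : Type := HalfDiagram n →₀ ℂ

/-- The basis vector of `U(n)` given by a half-diagram. -/
noncomputable def xi {n : ℕ} (a : HalfDiagram n) : U n := Finsupp.single a 1

/-! ### The sesquilinear form on `U(n)` -/

section Form

variable {n : ℕ}

/-- The edges of the graph obtained from `a` and `b` by identifying equal points. -/
def formEdge (a b : HalfDiagram n) (u v : Fin n) : Prop :=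
  a.partner u = v ∨ b.partner u = v

/-- Being joined by an edge path. -/
def formSetoid (a b : HalfDiagram n) : Setoid (Fin n) :=
  Relation.EqvGen.setoid (formEdge a b)

/-- Some edge path joins two different through-strings of `a`, or two of `b`. -/
def formReturns (a b : HalfDiagram n) : Prop :=
  ∃ u v : Fin n, u ≠ v ∧ formSetoid a b u v ∧
    ((a.partner u = u ∧ a.partner v = v) ∨ (b.partner u = u ∧ b.partner v = v))

/-- The number of closed loops: connected components that meet no through-string. -/
noncomputable def formLoops (a b : HalfDiagram n) : ℕ :=
  Nat.card {c : Quotient (formSetoid a b) //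
    ∀ u : Fin n, Quotient.mk _ u = c → a.partner u ≠ u ∧ b.partner u ≠ u}

open Classical in
/-- The value of the form on two half-diagrams. -/
noncomputable def formBasis (q : ℝ) (a b : HalfDiagram n) : ℝ :=
  if formReturns a b then 0 else q ^ formLoops a b

/-- The form on `U(n)`, linear in the first and conjugate linear in the second variable. -/
noncomputable def form (q : ℝ) (v w : U n) : ℂ :=
  v.sum fun a x => w.sum fun b y => x * conj y * (formBasis q a b : ℂ)

end Form

/-! ### The action of diagrams of `TL_n` on `U(n)` -/

section Action

variable {n : ℕ}

/-- Point `j` (with `1 ≤ j ≤ n`) of a pairing on `2n` points. -/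
def leftPt (j : Fin n) : Fin (2 * n) := ⟨j, by omega⟩

/-- Point `2n - j + 1` (with `1 ≤ j ≤ n`) of a pairing on `2n` points; it is the point that
gets identified with point `j` of a half-diagram. -/
def rightPt (j : Fin n) : Fin (2 * n) := ⟨2 * n - 1 - j, by omega⟩

/-- The edges of the concatenation of the pairing `p` with the half-diagram `a`. -/
def actEdge (p : Pairing n) (a : HalfDiagram n) (u v : Fin (2 * n)) : Prop :=
  p.partner u = v ∨ ∃ j : Fin n, u = rightPt j ∧ v = rightPt (a.partner j)

/-- Being joined by an edge path. -/
def actSetoid (p : Pairing n) (a : HalfDiagram n) : Setoid (Fin (2 * n)) :=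
  Relation.EqvGen.setoid (actEdge p a)

/-- Some edge path joins two different through-strings of `a`. -/
def actReturns (p : Pairing n) (a : HalfDiagram n) : Prop :=
  ∃ j k : Fin n, j ≠ k ∧ a.partner j = j ∧ a.partner k = k ∧
    actSetoid p a (rightPt j) (rightPt k)

/-- The number of closed loops of the concatenation: connected components consisting of
identified points only, none of which has a through-string. -/
noncomputable def actLoops (p : Pairing n) (a : HalfDiagram n) : ℕ :=
  Nat.card {c : Quotient (actSetoid p a) //
    ∀ u : Fin (2 * n), Quotient.mk _ u = c → ∃ j : Fin n, u = rightPt j ∧ a.partner j ≠ j}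

/-- `b` is what is left of the concatenation when closed loops and identified points are
deleted: two points are paired in `b` exactly when an edge path joins them. -/
def IsConcat (p : Pairing n) (a b : HalfDiagram n) : Prop :=
  ∀ j k : Fin n, j ≠ k → (b.partner j = k ↔ actSetoid p a (leftPt j) (leftPt k))

open Classical in
/-- The action of a diagram on a half-diagram. If no through-strings of `a` are joined, then
there is exactly one `b` with `IsConcat p a b`, and the result is `q ^ c • xi b`. -/
noncomputable def actBasis (q : ℝ) (p : Pairing n) (a : HalfDiagram n) : U n :=
  if h : ¬ actReturns p a ∧ ∃ b, IsConcat p a b then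
    ((q : ℂ) ^ actLoops p a) • xi h.2.choose
  else 0

/-- The action of a diagram on `U(n)`. -/
noncomputable def act (q : ℝ) (p : Pairing n) : U n →ₗ[ℂ] U n :=
  Finsupp.linearCombination ℂ (actBasis q p)

/-- The diagram `e_{i+1}` (with `1 ≤ i + 1 ≤ n - 1`): it pairs the points with values `i` and
`i + 1`, the points opposite to them, and every other point with its opposite point. -/
def gen (n i : ℕ) (hi : i + 1 < n) : Pairing n where
  partner j := ⟨if j.1 = i then i + 1 else if j.1 = i + 1 then i
    else if j.1 = 2 * n - 1 - i then 2 * n - 2 - i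
    else if j.1 = 2 * n - 2 - i then 2 * n - 1 - i
    else 2 * n - 1 - j.1, by split_ifs <;> omega⟩
  partner_partner j := by
    ext
    simp only
    split_ifs <;> omega
  noncrossing j k := by
    simp only [Fin.lt_def]
    split_ifs <;> omega
  noncrossing_through j k := by
    simp only [Fin.lt_def, Fin.ext_iff]
    split_ifs <;> omega
  no_through j := by
    simp only [ne_eq, Fin.ext_iff]
    split_ifs <;> omega

end Action

/-! ### Brackets, heights, restricted sequences -/

namespace HalfDiagram

variable {n : ℕ}

/-- The bracket at `j` is a closing bracket; otherwise (paired with a later point, or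
carrying a through-string) it is an opening bracket. -/
def IsClosing (a : HalfDiagram n) (j : Fin n) : Prop := a.partner j < j

open Classical in
/-- The height `h_k`: opening minus closing brackets among the first `k` brackets. (There are
never more closing than opening ones, so the subtraction does not truncate.) -/
noncomputable def height (a : HalfDiagram n) (k : ℕ) : ℕ :=
  (Finset.univ.filter fun j : Fin n => j.1 < k ∧ ¬ a.IsClosing j).card -
    (Finset.univ.filter fun j : Fin n => j.1 < k ∧ a.IsClosing j).card

/-- The points with values `i` and `i + 1` are joined by an (innermost) arch. -/
def HasArch (a : HalfDiagram n) (i : ℕ) : Prop :=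
  ∃ hi : i + 1 < n, a.partner ⟨i, by omega⟩ = ⟨i + 1, hi⟩

/-- The order embedding of `n` points into `n + 2` points that omits the values `i, i + 1`. -/
def skip (i : ℕ) (j : Fin n) : Fin (n + 2) :=
  ⟨if j.1 < i then j.1 else j.1 + 2, by split_ifs <;> omega⟩

theorem partner_skip_ne {a : HalfDiagram (n + 2)} {i : ℕ} (h : a.HasArch i) (j : Fin n) :
    (a.partner (skip i j)).1 ≠ i ∧ (a.partner (skip i j)).1 ≠ i + 1 := by
  obtain ⟨hi, h⟩ := h
  have h' : a.partner ⟨i + 1, hi⟩ = ⟨i, by omega⟩ := by rw [← h, a.partner_partner]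
  have key := a.partner_partner (skip i j)
  constructor
  · intro e
    have e' : a.partner (skip i j) = ⟨i, by omega⟩ := Fin.ext e
    rw [e', h] at key
    have := congrArg Fin.val key
    simp only [skip] at this
    split_ifs at this <;> omega
  · intro e
    have e' : a.partner (skip i j) = ⟨i + 1, hi⟩ := Fin.ext e
    rw [e', h'] at key
    have := congrArg Fin.val key
    simp only [skip] at this
    split_ifs at this <;> omega

/-- The number of the point `k` after the points with values `i` and `i + 1` are removed. -/
def unskip (i k : ℕ) : ℕ := if k < i then k else k - 2

theorem skip_unskip {i : ℕ} (k : Fin (n + 2)) (h1 : k.1 ≠ i)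
    (h2 : k.1 ≠ i + 1) (hk : unskip i k.1 < n) : skip i (⟨unskip i k.1, hk⟩ : Fin n) = k := by
  ext
  simp only [skip, unskip]
  split_ifs <;> omega

theorem skip_lt_skip {i : ℕ} {j k : Fin n} : skip i j < skip i k ↔ j < k := by
  simp only [skip, Fin.lt_def]
  split_ifs <;> omega

theorem skip_injective (i : ℕ) : Function.Injective (skip i : Fin n → Fin (n + 2)) := by
  intro j k h
  have := congrArg Fin.val h
  simp only [skip] at this
  ext
  split_ifs at this <;> omega

/-- The partner function after removal of an arch. -/
def removePartner (a : HalfDiagram (n + 2)) (i : ℕ) (h : a.HasArch i) (j : Fin n) : Fin n :=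
  ⟨unskip i (a.partner (skip i j)).1, by
    have h1 := partner_skip_ne h j
    have h2 := (a.partner (skip i j)).2
    obtain ⟨hi, -⟩ := h
    unfold unskip
    split_ifs <;> omega⟩

theorem skip_removePartner (a : HalfDiagram (n + 2)) (i : ℕ) (h : a.HasArch i) (j : Fin n) :
    skip i (a.removePartner i h j) = a.partner (skip i j) :=
  skip_unskip _ (partner_skip_ne h j).1 (partner_skip_ne h j).2 _

/-- Remove the arch joining the points with values `i` and `i + 1`, and its two points. -/
def removeArch (a : HalfDiagram (n + 2)) (i : ℕ) (h : a.HasArch i) : HalfDiagram n where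
  partner := a.removePartner i h
  partner_partner j := by
    apply skip_injective i
    rw [skip_removePartner, skip_removePartner, a.partner_partner]
  noncrossing j k := by
    have := a.noncrossing (skip i j) (skip i k)
    rw [← skip_removePartner a i h, ← skip_removePartner a i h] at this
    simpa only [skip_lt_skip] using this
  noncrossing_through j k := by
    have := a.noncrossing_through (skip i j) (skip i k)
    rw [← skip_removePartner a i h, ← skip_removePartner a i h] at this
    simpa only [skip_lt_skip, (skip_injective i).eq_iff] using this

open Classical in
/-- The generalized restricted sequence `(a_1, …, a_p)`: if there is an arch, `a_1` is the
smallest number such that the points `a_1` and `a_1 + 1` are joined by an arch, and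
`(a_2, …, a_p)` is the sequence of the diagram with this leftmost innermost arch removed.
The diagram with through-strings only has the empty sequence. -/
noncomputable def restrictedSequence : {n : ℕ} → HalfDiagram n → List ℕ
  | 0, _ => []
  | 1, _ => []
  | _ + 2, a =>
    if h : ∃ i, a.HasArch i then
      (Nat.find h + 1) :: restrictedSequence (a.removeArch (Nat.find h) (Nat.find_spec h))
    else []

/-- The minimal diagrams, whose restricted sequence is `(1, …, 1)`. -/
def IsMinimal (a : HalfDiagram n) : Prop := ∀ x ∈ a.restrictedSequence, x = 1

/-- `b` arises from `a` by box addition at position `i + 1`: `a` has a minimum there (its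
bracket `i + 1` is closing and its bracket `i + 2` is opening), and `b` has the brackets of
`a`, except that bracket `i + 1` is opening and bracket `i + 2` is closing. -/
def IsBoxAddition (i : ℕ) (hi : i + 1 < n) (a b : HalfDiagram n) : Prop :=
  a.IsClosing ⟨i, by omega⟩ ∧ ¬ a.IsClosing ⟨i + 1, hi⟩ ∧
  ¬ b.IsClosing ⟨i, by omega⟩ ∧ b.IsClosing ⟨i + 1, hi⟩ ∧
  ∀ j : Fin n, j.1 ≠ i → j.1 ≠ i + 1 → (b.IsClosing j ↔ a.IsClosing j)

end HalfDiagram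

/-! ### Chebyshev polynomials and the second basis -/

/-- `Δ_k(q)`: the determinant of the `k × k` matrix with diagonal entries `q` and entries `1`
directly above and below the diagonal. -/
noncomputable def Delta (k : ℕ) (q : ℝ) : ℝ :=
  Matrix.det (Matrix.of fun i j : Fin k =>
    if i = j then q else if i.1 + 1 = j.1 ∨ j.1 + 1 = i.1 then 1 else 0)

/-- `μ_k = Δ_{k-1}(q) / Δ_k(q)`, where `Δ_{-1} = 0`. -/
noncomputable def mu (q : ℝ) : ℕ → ℝ
  | 0 => 0
  | k + 1 => Delta k q / Delta (k + 1) q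

/-- `SecondBasis q a v`: the vector `v` is obtained as `ξ'_a` by some sequence of white box
additions, starting from a minimal diagram. -/
inductive SecondBasis (q : ℝ) {n : ℕ} : HalfDiagram n → U n → Prop
  | minimal (a : HalfDiagram n) (ha : a.IsMinimal) : SecondBasis q a (xi a)
  | box (i : ℕ) (hi : i + 1 < n) (a b : HalfDiagram n) (v : U n)
      (hab : HalfDiagram.IsBoxAddition i hi a b) (hv : SecondBasis q a v) :
      SecondBasis q b
        (act q (gen n i hi) v - ((mu q (a.height (i + 1) + 1) : ℝ) : ℂ) • v)

/-- The vector `ξ'_a` of the second basis. -/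
noncomputable def xiPrime (q : ℝ) {n : ℕ} (a : HalfDiagram n) : U n :=
  Classical.epsilon (SecondBasis q a)

end TemperleyLieb

/-! In purely combinatorial terms, `e_i` joins the points `i` and `i+1` of a half-diagram and joins
their former partners, with a factor `q`, `0` or `1` (`act_gen`). The relations `e_i² = q e_i`, `e_i
e_{i±1} e_i = e_i`, the commutation of distant generators and the self-adjointness of `e_i` thus
become statements about involutions and about components of graphs.

A half-diagram is determined by its bracket word, and every word of nonnegative height occurs. As a
multiset, the restricted sequence consists of the heights at which brackets close
(`coe_restrictedSequence`): the leftmost innermost arch closes at height `a_1`, and removing it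
changes no other closing height. Box additions are undone at peaks. Different peaks are at least two
apart, so the corresponding operators commute and `ξ'` is independent of the order of additions
(`IsPeak.wordVec`).

The nonvanishing of the `Δ_k` gives `μ_{k+1}(q - μ_k) = 1`. This has two consequences, each proved
by peeling off boxes. First, `e_i ξ'_f = 0` where the word `f` has two equal letters at `i, i+1`
(`genOp_wordVec_slope`). Second, if `g` has a minimum at `i`, then `e_1 ⋯ e_i ξ'_g = ξ'_{g'}`, where
`g'` arises from `g` by deleting the minimum and putting `()` in front (`genProd_wordVec_valley`).

For the norm, let `f` arise from `g` by a box at `i`, so that `ξ'_f = (e_i - μ_h) ξ'_g`. The closing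
heights of `f`, `g`, `g'` are `h+1`, `h`, `1` respectively, together with a common multiset `R`. Put
`P = ∏_{x ∈ R} 1/μ_x`. By induction `⟨ξ'_g, ξ'_g⟩ = P/μ_h` and `⟨ξ'_{g'}, ξ'_{g'}⟩ = qP`. The
relations give `‖e_1 ⋯ e_i v‖² = q⟨e_i v, v⟩`, whence `⟨e_i ξ'_g, ξ'_g⟩ = P`. Therefore `⟨ξ'_f,
ξ'_f⟩ = (q - 2μ_h)P + μ_h P = (q - μ_h)P = P/μ_{h+1}`. -/

namespace TemperleyLieb

/-! ### Joining two points of an involution -/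

section Join

variable {α : Type*} [DecidableEq α]

/-- Join the points `s` and `t` of an involution `p`, and also their former partners. -/
def joinFun (p : α → α) (s t x : α) : α :=
  if x = s then t else if x = t then s
  else if p x = s then (if p t = t then x else p t)
  else if p x = t then (if p s = s then x else p s)
  else p x

theorem joinFun_involutive {p : α → α} (hp : ∀ x, p (p x) = x) {s t : α} (x : α) :
    joinFun p s t (joinFun p s t x) = x := by
  unfold joinFun
  grind

theorem joinFun_comm {p : α → α} (hp : ∀ x, p (p x) = x) {s t u v x : α}
    (_h1 : ¬ (p s = s ∧ p t = t)) (_h2 : ¬ (p u = u ∧ p v = v))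
    (hsu : s ≠ u) (hsv : s ≠ v) (htu : t ≠ u) (htv : t ≠ v) (hst : s ≠ t) (huv : u ≠ v)
    (_h3 : ¬ (joinFun p s t u = u ∧ joinFun p s t v = v)) :
    joinFun (joinFun p s t) u v x = joinFun (joinFun p u v) s t x := by
  have h1 := hp x
  have h2 := hp s
  have h3 := hp t
  have h4 := hp u
  have h5 := hp v
  unfold joinFun at *
  grind (splits := 40)

/-- This underlies `e_i e_{i±1} e_i = e_i`: joining `t` to `u` hands the old partner of `u` over to
`s`, and rejoining `s` to `t` hands it back to `u`. If `u` is fixed, it is the fixed end that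
wanders in this way. -/
theorem joinFun_braid {p : α → α} (hp : ∀ x, p (p x) = x) {s t u x : α}
    (hst : s ≠ t) (hsu : s ≠ u) (htu : t ≠ u) (h : p s = t) :
    joinFun (joinFun p t u) s t x = p x := by
  have h1 := hp x
  have h2 := hp s
  have h3 := hp t
  have h4 := hp u
  unfold joinFun at *
  grind

theorem joinFun_symm {p : α → α} (hp : ∀ x, p (p x) = x) {s t : α} :
    joinFun p s t = joinFun p t s := by
  ext x
  have := hp x
  unfold joinFun
  grind

/-- The scalar that comes with joining `s` and `t`: `q` if they are partners already, `0` if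
both are fixed, and `1` otherwise. -/
def joinWeight (q : ℝ) (p : α → α) (s t : α) : ℝ :=
  if p s = t then q else if p s = s ∧ p t = t then 0 else 1

theorem joinWeight_symm (q : ℝ) {p : α → α} (hp : ∀ x, p (p x) = x) {s t : α} :
    joinWeight q p s t = joinWeight q p t s := by
  have := hp s
  have := hp t
  unfold joinWeight
  grind

theorem joinWeight_braid (q : ℝ) {p : α → α} (hp : ∀ x, p (p x) = x) {s t u : α}
    (hst : s ≠ t) (hsu : s ≠ u) (htu : t ≠ u) (h : p s = t) :
    joinWeight q p t u = 1 ∧ joinWeight q (joinFun p t u) s t = 1 := by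
  have h2 := hp s
  have h4 := hp u
  unfold joinWeight joinFun
  grind

theorem joinWeight_comm (q : ℝ) {p : α → α} (hp : ∀ x, p (p x) = x) {s t u v : α}
    (hsu : s ≠ u) (hsv : s ≠ v) (htu : t ≠ u) (htv : t ≠ v) (hst : s ≠ t) (huv : u ≠ v) :
    joinWeight q p s t * joinWeight q (joinFun p s t) u v =
      joinWeight q p u v * joinWeight q (joinFun p u v) s t := by
  have h2 := hp s
  have h3 := hp t
  have h4 := hp u
  have h5 := hp v
  unfold joinWeight joinFun
  rw [if_neg hsu.symm, if_neg htu.symm, if_neg hsv.symm, if_neg htv.symm, if_neg hsu, if_neg hsv,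
    if_neg htu, if_neg htv]
  grind (splits := 40)

end Join

/-! ### Joining neighbouring points of a half-diagram, and the relations this satisfies -/

namespace HalfDiagram

variable {n : ℕ}

theorem partner_injective (a : HalfDiagram n) : Function.Injective a.partner :=
  fun i j h => by rw [← a.partner_partner i, h, a.partner_partner]

/-- Both planarity axioms in one usable form: `noncrossing` at `u` excludes a partner of `v` beyond
the arch, and `noncrossing` at the partner of `v` excludes one in front of it. -/
theorem partner_inside (a : HalfDiagram n) {u v : Fin n} (h1 : u < v) (h2 : v < a.partner u) :
    u < a.partner v ∧ a.partner v < a.partner u ∧ a.partner v ≠ v := by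
  have e1 := a.noncrossing u v
  have e2 := a.noncrossing_through u v
  have e3 := a.noncrossing (a.partner v) u
  have e4 := a.partner_injective.ne h1.ne
  have e5 := a.partner_partner v
  have e6 : a.partner v ≠ u := by rintro rfl; rw [e5] at h2; exact h2.false
  rw [e5] at e3
  refine ⟨?_, ?_, fun h => e2 ⟨h1, h2, h⟩⟩
  · by_contra h
    exact e3 ⟨lt_of_le_of_ne (not_lt.1 h) e6, h1, h2⟩
  · by_contra h
    exact e1 ⟨h1, h2, lt_of_le_of_ne (not_lt.1 h) e4⟩

/-- As `s` and `t` are neighbours, nothing separates them, so the new connection of their former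
partners can be drawn alongside the old arches without a crossing. -/
theorem joinFun_inside (a : HalfDiagram n) {s t : Fin n} (hst : s.1 + 1 = t.1) {j k : Fin n}
    (e1 : j < k) (e2 : k < joinFun a.partner s t j) :
    j < joinFun a.partner s t k ∧ joinFun a.partner s t k < joinFun a.partner s t j ∧
      joinFun a.partner s t k ≠ k := by
  have hp := a.partner_partner
  have ins := fun u v => a.partner_inside (u := u) (v := v)
  generalize a.partner = p at *
  have h1 := hp j
  have h2 := hp k
  have h3 := hp s
  have h4 := hp t
  unfold joinFun at *
  -- A violation for the joined diagram would already violate planarity of `p` at one of finitely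
  -- many pairs made of `j`, `k`, `s`, `t` and their partners. The relevant instances are collected
  -- here for the final case distinction.
  have a1 := ins j k
  have a2 := ins j s
  have a3 := ins j t
  have a4 := ins s k
  have a5 := ins t k
  have a6 := ins (p s) k
  have a7 := ins (p t) k
  have a8 := ins s t
  have a9 := ins (p t) s
  rw [h3] at a6
  rw [h4] at a7 a9
  have b1 : p k = s → p s = k := fun h => by rw [← h, h2]
  have b2 : p k = t → p t = k := fun h => by rw [← h, h2]
  have b3 : p j = s → p s = j := fun h => by rw [← h, h1]
  have b4 : p j = t → p t = j := fun h => by rw [← h, h1]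
  have b6 : p k = j → p j = k := fun h => by rw [← h, h2]
  have b7 : p k = p s → k = s := fun h => by rw [← h2, h, h3]
  have b8 : p k = p t → k = t := fun h => by rw [← h2, h, h4]
  have b5 : p s ≠ p t := fun h => by
    have := congrArg p h
    rw [h3, h4] at this
    omega
  by_cases c1 : j = s
  · exfalso; simp only [if_pos c1] at e2; omega
  by_cases c2 : j = t
  · exfalso; rw [if_neg c1, if_pos c2] at e2; omega
  rw [if_neg c1, if_neg c2] at *
  have c1 := ins t (p k)
  have c2 := ins s (p k)
  have c3 := ins (p s) (p k)
  have c4 := ins (p t) (p k)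
  rw [h2] at c1 c2 c3 c4
  rw [h3] at c3
  rw [h4] at c4
  clear ins h1 h2 h3 h4 hp
  split_ifs at e2 ⊢
  all_goals grind

/-- Join the points with values `i` and `i + 1` of a half-diagram, and also their former
partners. -/
def join (a : HalfDiagram n) (i : ℕ) (hi : i + 1 < n) : HalfDiagram n where
  partner := joinFun a.partner ⟨i, by omega⟩ ⟨i + 1, hi⟩
  partner_partner := joinFun_involutive a.partner_partner
  noncrossing j k := fun ⟨h1, h2, h3⟩ => by
    have := (a.joinFun_inside (s := ⟨i, by omega⟩) (t := ⟨i + 1, hi⟩) rfl h1 h2).2.1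
    exact (this.trans h3).false
  noncrossing_through j k := fun ⟨h1, h2, h3⟩ =>
    (a.joinFun_inside (s := ⟨i, by omega⟩) (t := ⟨i + 1, hi⟩) rfl h1 h2).2.2 h3

/-- The scalar by which `e_{i+1}` multiplies the half-diagram `a.join i hi`. -/
def weight (q : ℝ) (a : HalfDiagram n) (i : ℕ) (hi : i + 1 < n) : ℝ :=
  joinWeight q a.partner ⟨i, by omega⟩ ⟨i + 1, hi⟩

theorem join_partner_left (a : HalfDiagram n) {i : ℕ} (hi : i + 1 < n) :
    (a.join i hi).partner ⟨i, by omega⟩ = ⟨i + 1, hi⟩ := by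
  simp [join, joinFun]

theorem join_partner_right (a : HalfDiagram n) {i : ℕ} (hi : i + 1 < n) :
    (a.join i hi).partner ⟨i + 1, hi⟩ = ⟨i, by omega⟩ := by
  simp [join, joinFun]

theorem join_of_arch (a : HalfDiagram n) {i : ℕ} (hi : i + 1 < n)
    (h : a.partner ⟨i, by omega⟩ = ⟨i + 1, hi⟩) : a.join i hi = a := by
  have h' : a.partner ⟨i + 1, hi⟩ = ⟨i, by omega⟩ := by rw [← h, a.partner_partner]
  ext x : 2
  have := a.partner_partner x
  simp only [join, joinFun]
  grind

theorem weight_join (q : ℝ) (a : HalfDiagram n) {i : ℕ} (hi : i + 1 < n) :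
    (a.join i hi).weight q i hi = q := by
  rw [weight, joinWeight, if_pos (a.join_partner_left hi)]

theorem join_join_up (a : HalfDiagram n) {i : ℕ} (hi : i + 2 < n)
    (h : a.partner ⟨i, by omega⟩ = ⟨i + 1, by omega⟩) :
    (a.join (i + 1) hi).join i (by omega) = a := by
  ext x : 2
  simp only [join]
  exact joinFun_braid a.partner_partner (by simp) (by simp; omega) (by simp) h

theorem join_join_down (a : HalfDiagram n) {i : ℕ} (hi : i + 2 < n)
    (h : a.partner ⟨i + 1, by omega⟩ = ⟨i + 2, by omega⟩) :
    (a.join i (by omega)).join (i + 1) hi = a := by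
  have h' : a.partner ⟨i + 2, hi⟩ = ⟨i + 1, by omega⟩ := by rw [← h, a.partner_partner]
  ext x : 2
  simp only [join]
  rw [joinFun_symm (joinFun_involutive a.partner_partner), joinFun_symm a.partner_partner]
  exact joinFun_braid a.partner_partner (by simp) (by simp; omega) (by simp) h'

theorem weight_up (q : ℝ) (a : HalfDiagram n) {i : ℕ} (hi : i + 2 < n)
    (h : a.partner ⟨i, by omega⟩ = ⟨i + 1, by omega⟩) :
    a.weight q (i + 1) hi = 1 ∧ (a.join (i + 1) hi).weight q i (by omega) = 1 :=
  joinWeight_braid q a.partner_partner (by simp) (by simp; omega) (by simp) h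

theorem weight_down (q : ℝ) (a : HalfDiagram n) {i : ℕ} (hi : i + 2 < n)
    (h : a.partner ⟨i + 1, by omega⟩ = ⟨i + 2, by omega⟩) :
    a.weight q i (by omega) = 1 ∧ (a.join i (by omega)).weight q (i + 1) hi = 1 := by
  have h' : a.partner ⟨i + 2, by omega⟩ = ⟨i + 1, by omega⟩ := by rw [← h, a.partner_partner]
  simp only [weight, join]
  rw [joinWeight_symm q (joinFun_involutive a.partner_partner), joinFun_symm a.partner_partner,
    joinWeight_symm q a.partner_partner]
  exact joinWeight_braid q a.partner_partner (by simp) (by simp; omega) (by simp) h'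

theorem join_join_comm (a : HalfDiagram n) {i j : ℕ} (hi : i + 1 < n) (hj : j + 1 < n)
    (hij : i + 2 ≤ j) (q : ℝ) (h1 : a.weight q i hi ≠ 0) (h2 : a.weight q j hj ≠ 0)
    (h3 : (a.join i hi).weight q j hj ≠ 0) :
    (a.join i hi).join j hj = (a.join j hj).join i hi := by
  ext x : 2
  have k1 : ∀ b : HalfDiagram n, ∀ k, ∀ hk : k + 1 < n, b.weight q k hk ≠ 0 →
      ¬ (b.partner ⟨k, by omega⟩ = ⟨k, by omega⟩ ∧ b.partner ⟨k + 1, hk⟩ = ⟨k + 1, hk⟩) := by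
    intro b k hk hb hc
    apply hb
    simp [weight, joinWeight, hc]
  simp only [join]
  exact joinFun_comm a.partner_partner (k1 _ _ _ h1) (k1 _ _ _ h2) (by simp; omega)
    (by simp; omega) (by simp; omega) (by simp; omega) (by simp) (by simp) (k1 _ _ _ h3)

theorem weight_comm (a : HalfDiagram n) {i j : ℕ} (hi : i + 1 < n) (hj : j + 1 < n)
    (hij : i + 2 ≤ j) (q : ℝ) :
    a.weight q i hi * (a.join i hi).weight q j hj =
      a.weight q j hj * (a.join j hj).weight q i hi :=
  joinWeight_comm q a.partner_partner (by simp; omega) (by simp; omega) (by simp; omega)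
    (by simp; omega) (by simp) (by simp)

/-- The action of the diagram `e_{i+1}`, described by joining points. -/
noncomputable def joinOp (q : ℝ) (i : ℕ) (hi : i + 1 < n) : U n →ₗ[ℂ] U n :=
  Finsupp.linearCombination ℂ fun a => ((a.weight q i hi : ℝ) : ℂ) • xi (a.join i hi)

theorem joinOp_xi (q : ℝ) (i : ℕ) (hi : i + 1 < n) (a : HalfDiagram n) :
    joinOp q i hi (xi a) = ((a.weight q i hi : ℝ) : ℂ) • xi (a.join i hi) := by
  simp [joinOp, xi]

theorem hom_ext_xi {f g : U n →ₗ[ℂ] U n} (h : ∀ a, f (xi a) = g (xi a)) : f = g :=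
  Finsupp.lhom_ext' fun a => LinearMap.ext_ring (h a)

theorem joinOp_sq (q : ℝ) (i : ℕ) (hi : i + 1 < n) :
    joinOp q i hi * joinOp q i hi = (q : ℂ) • joinOp q i hi := by
  refine hom_ext_xi fun a => ?_
  simp only [Module.End.mul_apply, LinearMap.smul_apply, joinOp_xi, map_smul, weight_join]
  rw [join_of_arch _ _ (a.join_partner_left hi), smul_comm]

theorem joinOp_up (q : ℝ) (i : ℕ) (hi : i + 2 < n) :
    joinOp q i (by omega) * joinOp q (i + 1) hi * joinOp q i (by omega) =
      joinOp (n := n) q i (by omega) := by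
  refine hom_ext_xi fun a => ?_
  have h := a.join_partner_left (i := i) (by omega)
  simp only [Module.End.mul_apply, joinOp_xi, map_smul, weight_up q _ hi h, join_join_up _ hi h]
  simp

theorem joinOp_down (q : ℝ) (i : ℕ) (hi : i + 2 < n) :
    joinOp q (i + 1) hi * joinOp q i (by omega) * joinOp q (i + 1) hi =
      joinOp (n := n) q (i + 1) hi := by
  refine hom_ext_xi fun a => ?_
  have h := a.join_partner_left (i := i + 1) (by omega)
  simp only [Module.End.mul_apply, joinOp_xi, map_smul, weight_down q _ hi h, join_join_down _ hi h]
  simp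

theorem joinOp_comm (q : ℝ) {i j : ℕ} (hi : i + 1 < n) (hj : j + 1 < n) (hij : i + 2 ≤ j) :
    joinOp (n := n) q i hi * joinOp q j hj = joinOp q j hj * joinOp q i hi := by
  refine hom_ext_xi fun a => ?_
  have hw := a.weight_comm hi hj hij q
  simp only [Module.End.mul_apply, joinOp_xi, map_smul, smul_smul, ← Complex.ofReal_mul]
  rw [hw]
  by_cases h : a.weight q j hj * (a.join j hj).weight q i hi = 0
  · rw [h]; simp
  · rw [join_join_comm a hi hj hij q (left_ne_zero_of_mul (hw ▸ h)) (left_ne_zero_of_mul h)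
      (right_ne_zero_of_mul (hw ▸ h))]

end HalfDiagram

/-! ### Concatenation with a generator is joining of points -/

section ActionOfGenerators

variable {n : ℕ}

theorem leftPt_or_rightPt (u : Fin (2 * n)) : ∃ j : Fin n, u = leftPt j ∨ u = rightPt j := by
  by_cases h : u.1 < n
  · exact ⟨⟨u.1, h⟩, Or.inl rfl⟩
  · refine ⟨⟨2 * n - 1 - u.1, by omega⟩, Or.inr ?_⟩
    ext
    simp only [rightPt]
    omega

theorem rightPt_injective : Function.Injective (rightPt : Fin n → Fin (2 * n)) := by
  intro j k h
  have := congrArg Fin.val h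
  simp only [rightPt] at this
  ext
  omega

theorem leftPt_ne_rightPt (j k : Fin n) : leftPt j ≠ rightPt k := by
  intro h
  have := congrArg Fin.val h
  simp only [rightPt, leftPt] at this
  omega

theorem gen_partner_leftPt {i : ℕ} (hi : i + 1 < n) {j : Fin n} (h1 : j ≠ ⟨i, by omega⟩)
    (h2 : j ≠ ⟨i + 1, hi⟩) : (gen n i hi).partner (leftPt j) = rightPt j := by
  have h1' : j.1 ≠ i := fun h => h1 (Fin.ext h)
  have h2' : j.1 ≠ i + 1 := fun h => h2 (Fin.ext h)
  ext
  simp only [gen, leftPt, rightPt]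
  split_ifs <;> omega

theorem gen_partner_rightPt {i : ℕ} (hi : i + 1 < n) {j : Fin n} (h1 : j ≠ ⟨i, by omega⟩)
    (h2 : j ≠ ⟨i + 1, hi⟩) : (gen n i hi).partner (rightPt j) = leftPt j := by
  rw [← gen_partner_leftPt hi h1 h2, (gen n i hi).partner_partner]

theorem gen_partner_leftPt_left {i : ℕ} (hi : i + 1 < n) :
    (gen n i hi).partner (leftPt ⟨i, by omega⟩) = leftPt ⟨i + 1, hi⟩ := by
  ext
  simp [gen, leftPt]

theorem gen_partner_leftPt_right {i : ℕ} (hi : i + 1 < n) :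
    (gen n i hi).partner (leftPt ⟨i + 1, hi⟩) = leftPt ⟨i, by omega⟩ := by
  rw [← gen_partner_leftPt_left hi, (gen n i hi).partner_partner]

theorem gen_partner_rightPt_left {i : ℕ} (hi : i + 1 < n) :
    (gen n i hi).partner (rightPt ⟨i, by omega⟩) = rightPt ⟨i + 1, hi⟩ := by
  ext
  simp only [gen, rightPt]
  split_ifs <;> omega

theorem gen_partner_rightPt_right {i : ℕ} (hi : i + 1 < n) :
    (gen n i hi).partner (rightPt ⟨i + 1, hi⟩) = rightPt ⟨i, by omega⟩ := by
  rw [← gen_partner_rightPt_left hi, (gen n i hi).partner_partner]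

/-- Identifies the diagram chosen in `actBasis` as soon as one diagram with the property is known.
-/
theorem IsConcat.unique {p : Pairing n} {a b b' : HalfDiagram n} (h : IsConcat p a b)
    (h' : IsConcat p a b') : b = b' := by
  ext j : 2
  by_cases hj : b.partner j = j
  · by_contra hne
    have h2 : b'.partner j ≠ j := fun h2 => hne (hj.trans h2.symm)
    exact hne ((h _ _ h2.symm).2 ((h' _ _ h2.symm).1 rfl))
  · exact ((h' _ _ (Ne.symm hj)).2 ((h _ _ (Ne.symm hj)).1 rfl)).symm

theorem actSetoid_partner (p : Pairing n) (a : HalfDiagram n) (u : Fin (2 * n)) :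
    actSetoid p a u (p.partner u) := Relation.EqvGen.rel _ _ (Or.inl rfl)

theorem actSetoid_rightPt (p : Pairing n) (a : HalfDiagram n) (j : Fin n) :
    actSetoid p a (rightPt j) (rightPt (a.partner j)) :=
  Relation.EqvGen.rel _ _ (Or.inr ⟨j, rfl, rfl⟩)

theorem actSetoid_gen_leftPt_rightPt (a : HalfDiagram n) {i : ℕ} (hi : i + 1 < n) {j : Fin n}
    (h1 : j ≠ ⟨i, by omega⟩) (h2 : j ≠ ⟨i + 1, hi⟩) :
    actSetoid (gen n i hi) a (leftPt j) (rightPt j) := by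
  have := actSetoid_partner (gen n i hi) a (leftPt j)
  rwa [gen_partner_leftPt hi h1 h2] at this

theorem actSetoid_gen_rightPt_rightPt (a : HalfDiagram n) {i : ℕ} (hi : i + 1 < n) :
    actSetoid (gen n i hi) a (rightPt ⟨i, by omega⟩) (rightPt ⟨i + 1, hi⟩) := by
  have := actSetoid_partner (gen n i hi) a (rightPt ⟨i, by omega⟩)
  rwa [gen_partner_rightPt_left hi] at this

/-- A point among `1, …, n` to which a point of the concatenation of `e_{i+1}` and `a` is
connected (`none` for the points of a closed loop). -/
def actLabel (a : HalfDiagram n) (i : ℕ) (hi : i + 1 < n) (u : Fin (2 * n)) : Option (Fin n) :=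
  if h : u.1 < n then some ⟨u.1, h⟩
  else if 2 * n - 1 - u.1 = i ∨ 2 * n - 1 - u.1 = i + 1 then
    if a.partner ⟨i, by omega⟩ = ⟨i + 1, hi⟩ then none
    else if a.partner ⟨i, by omega⟩ = ⟨i, by omega⟩ then some (a.partner ⟨i + 1, hi⟩)
    else some (a.partner ⟨i, by omega⟩)
  else some ⟨2 * n - 1 - u.1, by omega⟩

theorem actLabel_leftPt (a : HalfDiagram n) {i : ℕ} (hi : i + 1 < n) (j : Fin n) :
    actLabel a i hi (leftPt j) = some j := by
  simp [actLabel, leftPt]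

theorem actLabel_rightPt (a : HalfDiagram n) {i : ℕ} (hi : i + 1 < n) (j : Fin n) :
    actLabel a i hi (rightPt j) = if j = ⟨i, by omega⟩ ∨ j = ⟨i + 1, hi⟩ then
      if a.partner ⟨i, by omega⟩ = ⟨i + 1, hi⟩ then none
      else if a.partner ⟨i, by omega⟩ = ⟨i, by omega⟩ then some (a.partner ⟨i + 1, hi⟩)
      else some (a.partner ⟨i, by omega⟩) else some j := by
  have h1 : ¬ 2 * n - 1 - j.1 < n := by omega
  have h2 : 2 * n - 1 - (2 * n - 1 - j.1) = j.1 := by omega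
  simp only [actLabel, rightPt, dif_neg h1, h2, Fin.ext_iff]

/-- Two labels are equal or partners in the half-diagram. -/
def LabelRel (b : HalfDiagram n) (o o' : Option (Fin n)) : Prop :=
  o = o' ∨ ∃ x, o = some x ∧ o' = some (b.partner x)

theorem labelRel_equivalence (b : HalfDiagram n) : Equivalence (LabelRel b) where
  refl _ := Or.inl rfl
  symm := by
    rintro o o' (rfl | ⟨x, rfl, rfl⟩)
    · exact Or.inl rfl
    · exact Or.inr ⟨b.partner x, rfl, by rw [b.partner_partner]⟩
  trans := by
    rintro o o' o'' (rfl | ⟨x, rfl, rfl⟩) (rfl | ⟨y, h, rfl⟩)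
    · exact Or.inl rfl
    · exact Or.inr ⟨y, h, rfl⟩
    · exact Or.inr ⟨x, rfl, rfl⟩
    · left
      rw [← Option.some_injective _ h, b.partner_partner]

/-- The label, up to partners in the joined diagram, is preserved by every edge and hence is an
invariant of paths. It shows which points are not connected; `actSetoid_of_join` supplies the
connections. -/
theorem labelRel_of_actSetoid (a : HalfDiagram n) {i : ℕ} (hi : i + 1 < n)
    {u v : Fin (2 * n)} (h : actSetoid (gen n i hi) a u v) :
    LabelRel (a.join i hi) (actLabel a i hi u) (actLabel a i hi v) := by
  have eqv := labelRel_equivalence (a.join i hi)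
  induction (h : Relation.EqvGen _ u v) with
  | refl => exact eqv.refl _
  | symm _ _ _ ih => exact eqv.symm ih
  | trans _ _ _ _ _ ih1 ih2 => exact eqv.trans ih1 ih2
  | rel u v huv =>
    rcases huv with rfl | ⟨j, rfl, rfl⟩
    · obtain ⟨j, rfl | rfl⟩ := leftPt_or_rightPt u
      · by_cases h1 : j = ⟨i, by omega⟩
        · subst h1
          rw [gen_partner_leftPt_left, actLabel_leftPt, actLabel_leftPt]
          exact Or.inr ⟨_, rfl, by rw [a.join_partner_left hi]⟩
        by_cases h2 : j = ⟨i + 1, hi⟩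
        · subst h2
          rw [gen_partner_leftPt_right, actLabel_leftPt, actLabel_leftPt]
          exact Or.inr ⟨_, rfl, by rw [a.join_partner_right hi]⟩
        rw [gen_partner_leftPt hi h1 h2, actLabel_leftPt, actLabel_rightPt, if_neg (by tauto)]
        exact eqv.refl _
      · by_cases h1 : j = ⟨i, by omega⟩
        · subst h1
          rw [gen_partner_rightPt_left, actLabel_rightPt, actLabel_rightPt]
          exact Or.inl (by simp)
        by_cases h2 : j = ⟨i + 1, hi⟩
        · subst h2
          rw [gen_partner_rightPt_right, actLabel_rightPt, actLabel_rightPt]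
          exact Or.inl (by simp)
        rw [gen_partner_rightPt hi h1 h2, actLabel_leftPt, actLabel_rightPt, if_neg (by tauto)]
        exact eqv.refl _
    · rw [actLabel_rightPt, actLabel_rightPt]
      have h1 := a.partner_partner j
      have h2 := a.partner_partner ⟨i, by omega⟩
      have h3 := a.partner_partner ⟨i + 1, hi⟩
      simp only [LabelRel, HalfDiagram.join, joinFun]
      grind

/-- The path from `j` crosses over and follows its arch in `a`. If it arrives at one of the points
`i`, `i+1`, it turns along the right-hand arch of the generator and continues from the other one. -/
theorem actSetoid_of_join (a : HalfDiagram n) {i : ℕ} (hi : i + 1 < n) (j : Fin n) :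
    actSetoid (gen n i hi) a (leftPt j) (leftPt ((a.join i hi).partner j)) := by
  have key := @actSetoid_gen_leftPt_rightPt _ a _ hi
  have hst := actSetoid_gen_rightPt_rightPt a hi
  have hp := actSetoid_rightPt (gen n i hi) a
  have hl : actSetoid (gen n i hi) a (leftPt ⟨i, by omega⟩) (leftPt ⟨i + 1, hi⟩) := by
    have := actSetoid_partner (gen n i hi) a (leftPt ⟨i, by omega⟩)
    rwa [gen_partner_leftPt_left hi] at this
  generalize actSetoid (gen n i hi) a = R at *
  simp only [HalfDiagram.join, joinFun]
  have h1 := a.partner_partner j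
  have h2 := a.partner_partner ⟨i, by omega⟩
  have h3 := a.partner_partner ⟨i + 1, hi⟩
  by_cases e1 : j = ⟨i, by omega⟩
  · rw [if_pos e1, e1]; exact hl
  rw [if_neg e1]
  by_cases e2 : j = ⟨i + 1, hi⟩
  · rw [if_pos e2, e2]; exact R.symm hl
  rw [if_neg e2]
  have hj := R.trans (key e1 e2) (hp j)
  by_cases e3 : a.partner j = ⟨i, by omega⟩
  · rw [if_pos e3]
    split_ifs with e4
    · exact R.refl _
    · rw [e3] at hj
      exact R.trans hj (R.trans hst (R.trans (hp _) (R.symm (key (by grind) e4))))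
  rw [if_neg e3]
  by_cases e4 : a.partner j = ⟨i + 1, hi⟩
  · rw [if_pos e4]
    split_ifs with e5
    · exact R.refl _
    · rw [e4] at hj
      exact R.trans hj (R.trans (R.symm hst) (R.trans (hp _) (R.symm (key e5 (by grind)))))
  rw [if_neg e4]
  exact R.trans hj (R.symm (key e3 e4))

theorem isConcat_join (a : HalfDiagram n) {i : ℕ} (hi : i + 1 < n) :
    IsConcat (gen n i hi) a (a.join i hi) := by
  intro j k hjk
  constructor
  · rintro rfl
    exact actSetoid_of_join a hi j
  · intro h
    have := labelRel_of_actSetoid a hi h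
    rw [actLabel_leftPt, actLabel_leftPt] at this
    rcases this with h | ⟨x, h1, h2⟩
    · exact absurd (Option.some_injective _ h) hjk
    · rw [Option.some_injective _ h1, Option.some_injective _ h2]

theorem actReturns_gen_iff (a : HalfDiagram n) {i : ℕ} (hi : i + 1 < n) :
    actReturns (gen n i hi) a ↔
      a.partner ⟨i, by omega⟩ = ⟨i, by omega⟩ ∧ a.partner ⟨i + 1, hi⟩ = ⟨i + 1, hi⟩ := by
  constructor
  · rintro ⟨j, k, hjk, hj, hk, h⟩
    have := labelRel_of_actSetoid a hi h
    rw [actLabel_rightPt, actLabel_rightPt] at this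
    have h2 := a.partner_partner ⟨i, by omega⟩
    have h3 := a.partner_partner ⟨i + 1, hi⟩
    simp only [LabelRel, HalfDiagram.join, joinFun] at this
    grind
  · rintro ⟨h1, h2⟩
    exact ⟨_, _, by simp, h1, h2, actSetoid_gen_rightPt_rightPt a hi⟩

/-- The arch of `a` closes up with the right-hand arch of the generator. Every other point on the
right is connected to the left, so there is no second loop. -/
theorem actLoops_gen_of_arch (a : HalfDiagram n) {i : ℕ} (hi : i + 1 < n)
    (h : a.partner ⟨i, by omega⟩ = ⟨i + 1, hi⟩) : actLoops (gen n i hi) a = 1 := by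
  have h' : a.partner ⟨i + 1, hi⟩ = ⟨i, by omega⟩ := by rw [← h, a.partner_partner]
  rw [actLoops, Nat.card_eq_one_iff_unique]
  refine ⟨⟨?_⟩, ⟨⟨Quotient.mk _ (rightPt ⟨i, by omega⟩), ?_⟩⟩⟩
  · have key : ∀ c : Quotient (actSetoid (gen n i hi) a),
        (∀ u : Fin (2 * n), Quotient.mk _ u = c → ∃ j : Fin n, u = rightPt j ∧ a.partner j ≠ j) →
        c = Quotient.mk _ (rightPt ⟨i, by omega⟩) := by
      intro c
      induction c using Quotient.inductionOn with | _ u => ?_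
      intro hc
      obtain ⟨j, rfl, -⟩ := hc u rfl
      by_cases h1 : j = ⟨i, by omega⟩
      · rw [h1]
      by_cases h2 : j = ⟨i + 1, hi⟩
      · rw [h2]
        exact Quotient.sound (Setoid.symm' _ (actSetoid_gen_rightPt_rightPt a hi))
      obtain ⟨k, hk, -⟩ := hc (leftPt j) (Quotient.sound (actSetoid_gen_leftPt_rightPt a hi h1 h2))
      exact absurd hk (leftPt_ne_rightPt _ _)
    rintro ⟨c, hc⟩ ⟨d, hd⟩
    exact Subtype.ext ((key c hc).trans (key d hd).symm)
  · intro u hu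
    have := labelRel_of_actSetoid a hi (Quotient.exact hu)
    obtain ⟨j, rfl | rfl⟩ := leftPt_or_rightPt u
    · rw [actLabel_leftPt, actLabel_rightPt] at this
      simp [LabelRel, h] at this
    · refine ⟨j, rfl, ?_⟩
      rw [actLabel_rightPt, actLabel_rightPt] at this
      simp only [LabelRel, h] at this
      grind

theorem actLoops_gen_of_not_arch (a : HalfDiagram n) {i : ℕ} (hi : i + 1 < n)
    (h : a.partner ⟨i, by omega⟩ ≠ ⟨i + 1, hi⟩) : actLoops (gen n i hi) a = 0 := by
  rw [actLoops, Nat.card_eq_zero]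
  refine Or.inl ⟨?_⟩
  rintro ⟨c, hc⟩
  induction c using Quotient.inductionOn with | _ u => ?_
  have key : ∀ j : Fin n, actSetoid (gen n i hi) a (rightPt j) u →
      j = ⟨i, by omega⟩ ∨ j = ⟨i + 1, hi⟩ := by
    intro j hj
    by_contra! hne
    obtain ⟨k, hk, -⟩ := hc (leftPt j) (Quotient.sound
      (Setoid.trans' _ (actSetoid_gen_leftPt_rightPt a hi hne.1 hne.2) hj))
    exact leftPt_ne_rightPt _ _ hk
  obtain ⟨j, rfl, -⟩ := hc u rfl
  have hs : actSetoid (gen n i hi) a (rightPt ⟨i, by omega⟩) (rightPt j) := by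
    rcases key j (Setoid.refl' _ _) with rfl | rfl
    · exact Setoid.refl' _ _
    · exact actSetoid_gen_rightPt_rightPt a hi
  obtain ⟨k, hk, hk2⟩ := hc _ (Quotient.sound hs)
  rw [← rightPt_injective hk] at hk2
  rcases key _ (Setoid.trans' _ (Setoid.symm' _ (actSetoid_rightPt _ a _)) hs) with h1 | h1
  · exact hk2 h1
  · exact h h1

/-- The three values of the weight are the three fates of the right-hand arch: it closes a loop, it
joins two through-strings, or neither. -/
theorem act_gen (q : ℝ) {i : ℕ} (hi : i + 1 < n) :
    act q (gen n i hi) = HalfDiagram.joinOp q i hi := by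
  refine HalfDiagram.hom_ext_xi fun a => ?_
  rw [HalfDiagram.joinOp_xi, act, xi, Finsupp.linearCombination_single, one_smul, actBasis]
  split_ifs with h
  · rw [h.2.choose_spec.unique (isConcat_join a hi)]
    congr 1
    rw [actReturns_gen_iff] at h
    rw [HalfDiagram.weight, joinWeight, if_neg h.1]
    split_ifs with h1
    · rw [actLoops_gen_of_arch a hi h1, pow_one]
    · rw [actLoops_gen_of_not_arch a hi h1, pow_zero, Complex.ofReal_one]
  · have h1 := (actReturns_gen_iff a hi).1 (by_contra fun h1 => h ⟨h1, _, isConcat_join a hi⟩)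
    rw [HalfDiagram.weight, joinWeight, if_neg (by rw [h1.1]; simp), if_pos h1]
    simp

end ActionOfGenerators

/-! ### Self-adjointness of the generators, and the norm of a diagram -/

section FormInvariance

variable {n : ℕ}

theorem formBasis_symm (q : ℝ) (a b : HalfDiagram n) : formBasis q a b = formBasis q b a := by
  have h : formEdge a b = formEdge b a := by
    ext u v
    exact or_comm
  have h1 : formReturns a b ↔ formReturns b a := by
    unfold formReturns formSetoid
    rw [h]
    simp only [or_comm]
  have h2 : formLoops a b = formLoops b a := by
    unfold formLoops formSetoid
    rw [h]
    simp only [and_comm]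
  unfold formBasis
  rw [h2]
  split_ifs <;> tauto

theorem formSetoid_left (a b : HalfDiagram n) (u : Fin n) : formSetoid a b u (a.partner u) :=
  Relation.EqvGen.rel _ _ (Or.inl rfl)

theorem formSetoid_right (a b : HalfDiagram n) (u : Fin n) : formSetoid a b u (b.partner u) :=
  Relation.EqvGen.rel _ _ (Or.inr rfl)

/-- With a varying target `S` this serves both to transport paths between graphs and to prove
invariants of paths. -/
theorem formSetoid_map {a b : HalfDiagram n} {S : Setoid (Fin n)} (f : Fin n → Fin n)
    (h1 : ∀ u, S (f u) (f (a.partner u))) (h2 : ∀ u, S (f u) (f (b.partner u))) {u v : Fin n}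
    (h : formSetoid a b u v) : S (f u) (f v) := by
  induction (h : Relation.EqvGen _ u v) with
  | refl => exact S.refl _
  | symm _ _ _ ih => exact S.symm ih
  | trans _ _ _ _ _ ih1 ih2 => exact S.trans ih1 ih2
  | rel u v huv =>
    rcases huv with rfl | rfl
    · exact h1 _
    · exact h2 _

/-- Move the points with values `i` and `i + 1` to a point outside connected to them. -/
def joinRep (b : HalfDiagram n) (i : ℕ) (hi : i + 1 < n) (u : Fin n) : Fin n :=
  if u = ⟨i, by omega⟩ ∨ u = ⟨i + 1, hi⟩ then
    if b.partner ⟨i, by omega⟩ = ⟨i, by omega⟩ then b.partner ⟨i + 1, hi⟩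
    else b.partner ⟨i, by omega⟩
  else u

variable {c b : HalfDiagram n} {i : ℕ} {hi : i + 1 < n}

theorem formSetoid_of_join (hc : c.partner ⟨i, by omega⟩ = ⟨i + 1, hi⟩) {u v : Fin n}
    (h : formSetoid c (b.join i hi) u v) : formSetoid c b u v := by
  refine formSetoid_map id (fun u => formSetoid_left c b u) (fun u => ?_) h
  have hst := formSetoid_left c b ⟨i, by omega⟩
  rw [hc] at hst
  have hp := formSetoid_right c b
  simp only [id, HalfDiagram.join, joinFun]
  generalize formSetoid c b = R at *
  split_ifs with e1 e2 e3 e4 e5 e6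
  · rw [e1]; exact hst
  · rw [e2]; exact R.symm hst
  · exact R.refl _
  · exact R.trans (e3 ▸ hp u) (R.trans hst (hp _))
  · exact R.refl _
  · exact R.trans (e5 ▸ hp u) (R.trans (R.symm hst) (hp _))
  · exact hp u

theorem formSetoid_joinRep (hc : c.partner ⟨i, by omega⟩ = ⟨i + 1, hi⟩) (u : Fin n) :
    formSetoid c b u (joinRep b i hi u) := by
  have hst := formSetoid_left c b ⟨i, by omega⟩
  rw [hc] at hst
  have hp := formSetoid_right c b
  simp only [joinRep]
  generalize formSetoid c b = R at *
  split_ifs with e1 e2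
  · rcases e1 with e1 | e1
    · rw [e1]; exact R.trans hst (hp _)
    · rw [e1]; exact hp _
  · rcases e1 with e1 | e1
    · rw [e1]; exact hp _
    · rw [e1]; exact R.trans (R.symm hst) (hp _)
  · exact R.refl _

/-- After joining, `i` and `i+1` split off as a component of their own. Paths can therefore be
transported only after these points are moved to a point outside. -/
theorem formSetoid_join_joinRep (hc : c.partner ⟨i, by omega⟩ = ⟨i + 1, hi⟩)
    (h1 : b.partner ⟨i, by omega⟩ ≠ ⟨i + 1, hi⟩) {u v : Fin n} (h : formSetoid c b u v) :
    formSetoid c (b.join i hi) (joinRep b i hi u) (joinRep b i hi v) := by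
  have hc' : c.partner ⟨i + 1, hi⟩ = ⟨i, by omega⟩ := by rw [← hc, c.partner_partner]
  refine formSetoid_map _ (fun u => ?_) (fun u => ?_) h
  · have hl := formSetoid_left c (b.join i hi) u
    have := c.partner_partner u
    simp only [joinRep]
    generalize formSetoid c (b.join i hi) = R at *
    have := R.refl'
    grind
  · have hl := formSetoid_right c (b.join i hi)
    have k1 := b.partner_partner u
    have k2 := b.partner_partner ⟨i, by omega⟩
    have k3 := b.partner_partner ⟨i + 1, hi⟩
    simp only [joinRep]
    generalize formSetoid c (b.join i hi) = R at *
    have := R.refl'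
    simp only [HalfDiagram.join, joinFun] at hl
    have l1 := hl u
    have l2 := hl (b.partner ⟨i, by omega⟩)
    have l3 := hl (b.partner ⟨i + 1, hi⟩)
    have l4 := R.symm' l1
    have l5 := R.symm' l2
    have l6 := R.symm' l3
    clear hl
    grind

theorem formSetoid_join_mem (hc : c.partner ⟨i, by omega⟩ = ⟨i + 1, hi⟩) {u v : Fin n}
    (h : formSetoid c (b.join i hi) u v) :
    (u = ⟨i, by omega⟩ ∨ u = ⟨i + 1, hi⟩) ↔ (v = ⟨i, by omega⟩ ∨ v = ⟨i + 1, hi⟩) := by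
  have hc' : c.partner ⟨i + 1, hi⟩ = ⟨i, by omega⟩ := by rw [← hc, c.partner_partner]
  have hb := b.join_partner_left hi
  have hb' := b.join_partner_right hi
  have aux : ∀ d : HalfDiagram n, d.partner ⟨i, by omega⟩ = ⟨i + 1, hi⟩ → ∀ u,
      ((u = ⟨i, by omega⟩ ∨ u = ⟨i + 1, hi⟩) ↔
        (d.partner u = ⟨i, by omega⟩ ∨ d.partner u = ⟨i + 1, hi⟩)) := by
    intro d hd u
    have hd' : d.partner ⟨i + 1, hi⟩ = ⟨i, by omega⟩ := by rw [← hd, d.partner_partner]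
    have := d.partner_partner u
    grind
  let S : Setoid (Fin n) := Setoid.comap (fun u => u = ⟨i, by omega⟩ ∨ u = ⟨i + 1, hi⟩)
    ⟨Iff, ⟨fun _ => Iff.rfl, Iff.symm, Iff.trans⟩⟩
  exact formSetoid_map (S := S) id (aux c hc) (aux _ hb) h

theorem join_through_joinRep (h1 : b.partner ⟨i, by omega⟩ ≠ ⟨i + 1, hi⟩)
    (h2 : ¬ (b.partner ⟨i, by omega⟩ = ⟨i, by omega⟩ ∧ b.partner ⟨i + 1, hi⟩ = ⟨i + 1, hi⟩))
    {u : Fin n} (hu : b.partner u = u) :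
    (b.join i hi).partner (joinRep b i hi u) = joinRep b i hi u := by
  have k2 := b.partner_partner ⟨i, by omega⟩
  have k3 := b.partner_partner ⟨i + 1, hi⟩
  simp only [joinRep, HalfDiagram.join, joinFun]
  grind

/-- A through-string of `b` from which a given through-string of `b.join i hi` stems. -/
theorem exists_through_of_join (hc : c.partner ⟨i, by omega⟩ = ⟨i + 1, hi⟩) {u : Fin n}
    (hu : (b.join i hi).partner u = u) :
    ∃ w, b.partner w = w ∧ formSetoid c b u w ∧ joinRep b i hi w = u := by
  have hst := formSetoid_left c b ⟨i, by omega⟩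
  rw [hc] at hst
  have hp := formSetoid_right c b u
  have k1 := b.partner_partner u
  have k2 := b.partner_partner ⟨i, by omega⟩
  have k3 := b.partner_partner ⟨i + 1, hi⟩
  simp only [HalfDiagram.join, joinFun] at hu
  simp only [joinRep]
  generalize formSetoid c b = R at *
  have hts := R.symm' hst
  by_cases e3 : b.partner u = ⟨i, by omega⟩
  · refine ⟨⟨i + 1, hi⟩, by grind, R.trans (e3 ▸ hp) hst, by grind⟩
  by_cases e4 : b.partner u = ⟨i + 1, hi⟩
  · refine ⟨⟨i, by omega⟩, by grind, R.trans (e4 ▸ hp) hts, by grind⟩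
  exact ⟨u, by grind, R.refl _, by grind⟩

theorem formReturns_join (hc : c.partner ⟨i, by omega⟩ = ⟨i + 1, hi⟩)
    (h1 : b.partner ⟨i, by omega⟩ ≠ ⟨i + 1, hi⟩)
    (h2 : ¬ (b.partner ⟨i, by omega⟩ = ⟨i, by omega⟩ ∧ b.partner ⟨i + 1, hi⟩ = ⟨i + 1, hi⟩)) :
    formReturns c (b.join i hi) ↔ formReturns c b := by
  have hc' : c.partner ⟨i + 1, hi⟩ = ⟨i, by omega⟩ := by rw [← hc, c.partner_partner]
  have k2 := b.partner_partner ⟨i, by omega⟩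
  have k3 := b.partner_partner ⟨i + 1, hi⟩
  constructor
  · rintro ⟨u, v, huv, h, ⟨hu, hv⟩ | ⟨hu, hv⟩⟩
    · exact ⟨u, v, huv, formSetoid_of_join hc h, Or.inl ⟨hu, hv⟩⟩
    · obtain ⟨u', hu1, hu2, rfl⟩ := exists_through_of_join hc hu
      obtain ⟨v', hv1, hv2, rfl⟩ := exists_through_of_join hc hv
      exact ⟨u', v', fun h => huv (by rw [h]), (formSetoid c b).trans ((formSetoid c b).symm hu2)
        ((formSetoid c b).trans (formSetoid_of_join hc h) hv2), Or.inr ⟨hu1, hv1⟩⟩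
  · rintro ⟨u, v, huv, h, ⟨hu, hv⟩ | ⟨hu, hv⟩⟩
    · have := formSetoid_join_joinRep hc h1 h
      refine ⟨_, _, ?_, this, Or.inl ?_⟩ <;> simp only [joinRep] <;> grind
    · have := formSetoid_join_joinRep hc h1 h
      refine ⟨_, _, ?_, this,
        Or.inr ⟨join_through_joinRep h1 h2 hu, join_through_joinRep h1 h2 hv⟩⟩
      simp only [joinRep]
      grind

theorem joinRep_not_mem (h1 : b.partner ⟨i, by omega⟩ ≠ ⟨i + 1, hi⟩)
    (h2 : ¬ (b.partner ⟨i, by omega⟩ = ⟨i, by omega⟩ ∧ b.partner ⟨i + 1, hi⟩ = ⟨i + 1, hi⟩))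
    (u : Fin n) : ¬ (joinRep b i hi u = ⟨i, by omega⟩ ∨ joinRep b i hi u = ⟨i + 1, hi⟩) := by
  have k2 := b.partner_partner ⟨i, by omega⟩
  have k3 := b.partner_partner ⟨i + 1, hi⟩
  simp only [joinRep]
  grind

/-- The extra loop consists of `i` and `i+1`, paired with each other by `c` and by the joined
diagram. The remaining loops correspond to those of `c` and `b` through `joinRep`. -/
theorem formLoops_join (hc : c.partner ⟨i, by omega⟩ = ⟨i + 1, hi⟩)
    (h1 : b.partner ⟨i, by omega⟩ ≠ ⟨i + 1, hi⟩)
    (h2 : ¬ (b.partner ⟨i, by omega⟩ = ⟨i, by omega⟩ ∧ b.partner ⟨i + 1, hi⟩ = ⟨i + 1, hi⟩)) :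
    formLoops c (b.join i hi) = formLoops c b + 1 := by
  have hc' : c.partner ⟨i + 1, hi⟩ = ⟨i, by omega⟩ := by rw [← hc, c.partner_partner]
  have hb := b.join_partner_left hi
  have hb' := b.join_partner_right hi
  have hne : (⟨i, by omega⟩ : Fin n) ≠ ⟨i + 1, hi⟩ := by simp
  rw [formLoops, formLoops, ← Finite.card_option]
  set R := formSetoid c b with hR
  set R' := formSetoid c (b.join i hi) with hR'
  let P : Quotient R → Prop := fun x =>
    ∀ u : Fin n, Quotient.mk _ u = x → c.partner u ≠ u ∧ b.partner u ≠ u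
  let P' : Quotient R' → Prop := fun x =>
    ∀ u : Fin n, Quotient.mk _ u = x → c.partner u ≠ u ∧ (b.join i hi).partner u ≠ u
  let r := joinRep b i hi
  let F : Quotient R → Quotient R' :=
    Quotient.map r fun u v huv => formSetoid_join_joinRep hc h1 huv
  have hF : ∀ x, P x → P' (F x) := by
    intro x
    induction x using Quotient.inductionOn with | _ u => ?_
    intro hx v hv
    have hvu : R v u := R.trans (formSetoid_of_join hc (Quotient.exact hv))
      (R.symm (formSetoid_joinRep hc u))
    refine ⟨(hx v (Quotient.sound hvu)).1, fun hv' => ?_⟩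
    obtain ⟨w, hw1, hw2, -⟩ := exists_through_of_join hc hv'
    exact (hx w (Quotient.sound (R.trans (R.symm hw2) hvu))).2 hw1
  have hF' : ∀ x, P' (F x) → P x := by
    intro x
    induction x using Quotient.inductionOn with | _ u => ?_
    intro hx v hv
    have hvu : R' (r v) (r u) := formSetoid_join_joinRep hc h1 (Quotient.exact hv)
    obtain ⟨g1, g2⟩ := hx _ (Quotient.sound hvu)
    refine ⟨fun hv' => ?_, fun hv' => g2 (join_through_joinRep h1 h2 hv')⟩
    apply g1
    simp only [r, joinRep]
    grind
  have hs : P' (Quotient.mk _ ⟨i, by omega⟩) := by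
    intro u hu
    have := (formSetoid_join_mem hc (Quotient.exact hu)).2 (Or.inl rfl)
    rcases this with rfl | rfl
    · rw [hc, hb]; exact ⟨hne.symm, hne.symm⟩
    · rw [hc', hb']; exact ⟨hne, hne⟩
  symm
  -- `none` is sent to the new loop on `i` and `i+1`, and `some x` to the loop inherited from `x`.
  refine Nat.card_eq_of_bijective (α := Option {x // P x}) (β := {x // P' x})
    (fun o => o.elim ⟨Quotient.mk _ ⟨i, by omega⟩, hs⟩ fun x => ⟨F x.1, hF _ x.2⟩) ⟨?_, ?_⟩
  · have hnot : ∀ x, F x ≠ Quotient.mk _ ⟨i, by omega⟩ := by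
      intro x
      induction x using Quotient.inductionOn with | _ u => ?_
      intro h
      exact joinRep_not_mem h1 h2 u ((formSetoid_join_mem hc (Quotient.exact h)).2 (Or.inl rfl))
    have hinj : ∀ x y, F x = F y → x = y := by
      intro x y
      induction x using Quotient.inductionOn with | _ u => ?_
      induction y using Quotient.inductionOn with | _ v => ?_
      intro h
      exact Quotient.sound (R.trans (formSetoid_joinRep hc u) (R.trans
        (formSetoid_of_join hc (Quotient.exact h)) (R.symm (formSetoid_joinRep hc v))))
    rintro (_ | ⟨x, hx⟩) (_ | ⟨y, hy⟩) h
    · rfl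
    · exact absurd (congrArg Subtype.val h).symm (hnot _)
    · exact absurd (congrArg Subtype.val h) (hnot _)
    · have := hinj _ _ (congrArg Subtype.val h)
      subst this
      rfl
  · rintro ⟨x, hx⟩
    induction x using Quotient.inductionOn with | _ u => ?_
    by_cases hu : u = ⟨i, by omega⟩ ∨ u = ⟨i + 1, hi⟩
    · refine ⟨none, Subtype.ext (Quotient.sound ?_)⟩
      rcases hu with rfl | rfl
      · exact R'.refl _
      · have := formSetoid_left c (b.join i hi) ⟨i, by omega⟩
        rwa [hc] at this
    · have hr : F (Quotient.mk _ u) = Quotient.mk _ u := by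
        change Quotient.mk _ (r u) = _
        simp only [r, joinRep, if_neg hu]
      exact ⟨some ⟨Quotient.mk _ u, hF' _ (hr ▸ hx)⟩, Subtype.ext hr⟩

/-- Self-adjointness in the special case `e_i c = q c`, to which the general case reduces. -/
theorem formBasis_arch (q : ℝ) (hc : c.partner ⟨i, by omega⟩ = ⟨i + 1, hi⟩) :
    q * formBasis q c b = b.weight q i hi * formBasis q c (b.join i hi) := by
  rw [HalfDiagram.weight, joinWeight]
  split_ifs with h1 h2
  · rw [b.join_of_arch hi h1]
  · have := formSetoid_left c b ⟨i, by omega⟩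
    rw [hc] at this
    rw [formBasis, if_pos ⟨_, _, by simp, this, Or.inr h2⟩]
    simp
  · rw [formBasis, formBasis, formLoops_join hc h1 h2]
    by_cases h : formReturns c b
    · rw [if_pos h, if_pos ((formReturns_join hc h1 h2).2 h)]
      simp
    · rw [if_neg h, if_neg (mt (formReturns_join hc h1 h2).1 h)]
      ring

/-- Both `a.join` and `b.join` have an arch at `i`. By `formBasis_arch`, `q` times either side
equals the product of both weights with the form of the two joined diagrams, which is symmetric in
`a` and `b`. -/
theorem formBasis_join {q : ℝ} (hq : q ≠ 0) (a b : HalfDiagram n) (hi : i + 1 < n) :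
    a.weight q i hi * formBasis q (a.join i hi) b =
      b.weight q i hi * formBasis q a (b.join i hi) := by
  refine mul_left_cancel₀ hq ?_
  have h1 := formBasis_arch (b := b) q (a.join_partner_left hi)
  have h2 := formBasis_arch (b := a) q (b.join_partner_left hi)
  rw [formBasis_symm q a, mul_left_comm, h1, mul_left_comm q, h2, formBasis_symm q (a.join i hi)]
  ring

theorem formSetoid_self (a : HalfDiagram n) {u v : Fin n} (h : formSetoid a a u v) :
    u = v ∨ a.partner u = v := by
  let S : Setoid (Fin n) := ⟨fun u v => u = v ∨ a.partner u = v, by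
    have := a.partner_partner
    constructor <;> grind⟩
  exact formSetoid_map (S := S) id (fun u => Or.inr rfl) (fun u => Or.inr rfl) h

/-- Each arch is doubled to one loop, which its closing point indexes. -/
theorem formBasis_self (q : ℝ) (a : HalfDiagram n) :
    formBasis q a a = q ^ Nat.card {j : Fin n // a.IsClosing j} := by
  have hr : ¬ formReturns a a := by
    rintro ⟨u, v, huv, h, h'⟩
    have := formSetoid_self a h
    grind
  rw [formBasis, if_neg hr, formLoops]
  congr 1
  symm
  refine Nat.card_eq_of_bijective (fun j => ⟨Quotient.mk _ j.1, fun u hu => ?_⟩) ⟨?_, ?_⟩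
  · have h1 := formSetoid_self a (Quotient.exact hu)
    have h2 : a.partner j.1 < j.1 := j.2
    have h3 := a.partner_partner u
    have : a.partner u ≠ u := by grind
    exact ⟨this, this⟩
  · rintro ⟨j, hj⟩ ⟨k, hk⟩ h
    have h1 := formSetoid_self a (Quotient.exact (congrArg Subtype.val h))
    have h3 := a.partner_partner j
    simp only [HalfDiagram.IsClosing] at hj hk
    ext
    grind
  · rintro ⟨x, hx⟩
    induction x using Quotient.inductionOn with | _ u => ?_
    have hne := (hx u rfl).1
    by_cases h : a.partner u < u
    · exact ⟨⟨u, h⟩, rfl⟩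
    · refine ⟨⟨a.partner u, ?_⟩, Subtype.ext (Quotient.sound ?_)⟩
      · rw [HalfDiagram.IsClosing, a.partner_partner]
        exact lt_of_le_of_ne (not_lt.1 h) (Ne.symm hne)
      · exact Setoid.symm' _ (formSetoid_left a a u)

/-- The form as a sesquilinear map. -/
noncomputable def formMap (q : ℝ) : U n →ₗ[ℂ] U n →ₗ⋆[ℂ] ℂ :=
  LinearMap.mk₂'ₛₗ (RingHom.id ℂ) (starRingEnd ℂ) (form q)
    (fun v v' w => by
      unfold form
      rw [Finsupp.sum_add_index' (by simp) (by
        intros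
        simp only [Finsupp.sum, ← Finset.sum_add_distrib]
        congr 1
        ext
        ring)])
    (fun x v w => by
      unfold form
      rw [Finsupp.sum_smul_index' (by simp)]
      simp only [Finsupp.sum, Finset.mul_sum, smul_eq_mul, RingHom.id_apply, mul_assoc])
    (fun v w w' => by
      unfold form
      simp only [Finsupp.sum, ← Finset.sum_add_distrib]
      congr 1
      ext a
      exact Finsupp.sum_add_index' (h := fun b y => v a * conj y * (formBasis q a b : ℂ)) (by simp)
        (by intros; simp only [map_add]; ring))
    (fun x v w => by
      unfold form
      rw [Finsupp.smul_sum]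
      congr 1
      ext a y
      rw [Finsupp.sum_smul_index' (by simp), Finsupp.smul_sum]
      congr 1
      ext b z
      simp only [smul_eq_mul, map_mul]
      ring)

theorem formMap_apply (q : ℝ) (v w : U n) : formMap q v w = form q v w := rfl

theorem formMap_xi (q : ℝ) (a b : HalfDiagram n) :
    formMap q (xi a) (xi b) = (formBasis q a b : ℂ) := by
  simp [formMap_apply, form, xi]

theorem formMap_joinOp {q : ℝ} (hq : q ≠ 0) (hi : i + 1 < n) (v w : U n) :
    formMap q (HalfDiagram.joinOp q i hi v) w = formMap q v (HalfDiagram.joinOp q i hi w) := by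
  induction v using Finsupp.induction_linear with
  | zero => simp
  | add v v' h h' => simp only [map_add, LinearMap.add_apply, h, h']
  | single a x =>
    induction w using Finsupp.induction_linear with
    | zero => simp
    | add w w' h h' => simp only [map_add, h, h']
    | single b y =>
      have hx : ∀ (a : HalfDiagram n) (x : ℂ), Finsupp.single a x = x • xi a := by simp [xi]
      have := congrArg (fun r : ℝ => (r : ℂ)) (formBasis_join hq a b hi)
      push_cast at this
      simp only [hx, map_smul, map_smulₛₗ, LinearMap.smul_apply, HalfDiagram.joinOp_xi, formMap_xi,
        smul_eq_mul, Complex.conj_ofReal]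
      rw [this]
      ring

end FormInvariance

/-! ### Bracket words -/

/-- The height of a word of opening (`true`) and closing (`false`) brackets after `k` letters. -/
def wordHeight (f : ℕ → Bool) : ℕ → ℕ
  | 0 => 0
  | k + 1 => if f k then wordHeight f k + 1 else wordHeight f k - 1

/-- Words with `n` letters (continued by opening brackets) whose heights are nonnegative. -/
structure IsWord (n : ℕ) (f : ℕ → Bool) : Prop where
  one_le : ∀ j, f j = false → 1 ≤ wordHeight f j
  tail : ∀ j, n ≤ j → f j = true

/-- The multiset of the heights at which brackets close. -/
def levels (n : ℕ) (f : ℕ → Bool) : Multiset ℕ :=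
  ∑ j ∈ Finset.range n, if f j then 0 else {wordHeight f j}

/-- The word has a maximum at `i + 1` that is the result of a box addition. -/
def IsPeak (f : ℕ → Bool) (i : ℕ) : Prop :=
  f i = true ∧ f (i + 1) = false ∧ 1 ≤ wordHeight f i

/-- Interchange the letters `i` and `i + 1`. -/
def swapLetters (f : ℕ → Bool) (i j : ℕ) : Bool :=
  if j = i then f (i + 1) else if j = i + 1 then f i else f j

/-- Remove the letters `i` and `i + 1` and put an opening and a closing bracket in front. -/
def moveToFront (f : ℕ → Bool) (i j : ℕ) : Bool :=
  if j = 0 then true else if j = 1 then false else if j < i + 2 then f (j - 2) else f j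

/-- Remove the letters `i` and `i + 1`. -/
def deleteLetters (f : ℕ → Bool) (i j : ℕ) : Bool := if j < i then f j else f (j + 2)

/-- The first closing bracket of the word is letter `i + 1`. -/
def IsFirstPeak (f : ℕ → Bool) (i : ℕ) : Prop := (∀ j ≤ i, f j = true) ∧ f (i + 1) = false

section Words

variable {n i j k : ℕ} {f g : ℕ → Bool}

theorem wordHeight_succ_of_true (h : f k = true) : wordHeight f (k + 1) = wordHeight f k + 1 := by
  simp [wordHeight, h]

theorem wordHeight_succ_of_false (h : f k = false) :
    wordHeight f (k + 1) = wordHeight f k - 1 := by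
  simp [wordHeight, h]

theorem wordHeight_congr (h : ∀ j < k, f j = g j) : wordHeight f k = wordHeight g k := by
  induction k with
  | zero => rfl
  | succ k ih =>
    rw [wordHeight, wordHeight, ih fun j hj => h j (by omega), h k (by omega)]

/-- Words that agree from some point on, up to a shift, have the same heights there if they have
the same height at one point. -/
theorem wordHeight_add (a b : ℕ) (h0 : wordHeight f a = wordHeight g b)
    (h : ∀ j, f (a + j) = g (b + j)) (k : ℕ) : wordHeight f (a + k) = wordHeight g (b + k) := by
  induction k with
  | zero => exact h0
  | succ k ih => rw [← add_assoc, ← add_assoc, wordHeight, wordHeight, ih, h]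

theorem mem_levels {x : ℕ} : x ∈ levels n f ↔ ∃ j < n, f j = false ∧ wordHeight f j = x := by
  simp only [levels, Multiset.mem_sum, Finset.mem_range]
  refine exists_congr fun j => and_congr_right fun _ => ?_
  cases f j <;> simp [eq_comm]

theorem IsWord.lt (hf : IsWord n f) (h : f j = false) : j < n := by
  by_contra hj
  rw [hf.tail j (by omega)] at h
  exact absurd h (by simp)

theorem IsWord.mem_levels (hf : IsWord n f) (h : f j = false) : wordHeight f j ∈ levels n f :=
  TemperleyLieb.mem_levels.2 ⟨j, hf.lt h, h, rfl⟩

theorem swapLetters_left : swapLetters f i i = f (i + 1) := by simp [swapLetters]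

theorem swapLetters_right : swapLetters f i (i + 1) = f i := by simp [swapLetters]

theorem swapLetters_of_ne (h1 : j ≠ i) (h2 : j ≠ i + 1) : swapLetters f i j = f j := by
  simp [swapLetters, h1, h2]

theorem swapLetters_comm (h : i + 2 ≤ j) :
    swapLetters (swapLetters f i) j = swapLetters (swapLetters f j) i := by
  ext k
  simp only [swapLetters]
  grind

theorem wordHeight_swapLetters_of_le (h : k ≤ i) :
    wordHeight (swapLetters f i) k = wordHeight f k :=
  wordHeight_congr fun _ _ => swapLetters_of_ne (by omega) (by omega)

theorem IsPeak.wordHeight_swapLetters_succ (h : IsPeak f i) :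
    wordHeight (swapLetters f i) (i + 1) = wordHeight f i - 1 := by
  rw [wordHeight_succ_of_false (swapLetters_left.trans h.2.1), wordHeight_swapLetters_of_le le_rfl]

theorem IsPeak.wordHeight_swapLetters (h : IsPeak f i) (hk : i + 2 ≤ k) :
    wordHeight (swapLetters f i) k = wordHeight f k := by
  obtain ⟨l, rfl⟩ := Nat.exists_eq_add_of_le hk
  refine wordHeight_add _ _ ?_ (fun j => swapLetters_of_ne (by omega) (by omega)) l
  rw [wordHeight_succ_of_true (k := i + 1) (swapLetters_right.trans h.1),
    h.wordHeight_swapLetters_succ, wordHeight_succ_of_false (k := i + 1) h.2.1,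
    wordHeight_succ_of_true h.1]
  have := h.2.2
  omega

theorem IsPeak.wordHeight_swapLetters_of_ne (h : IsPeak f i) (hk : k ≠ i + 1) :
    wordHeight (swapLetters f i) k = wordHeight f k := by
  rcases Nat.lt_or_ge k (i + 1) with h1 | h1
  · exact wordHeight_swapLetters_of_le (by omega)
  · exact h.wordHeight_swapLetters (by omega)

theorem IsPeak.isWord (h : IsPeak f i) (hf : IsWord n f) : IsWord n (swapLetters f i) where
  one_le j hj := by
    by_cases h1 : j = i
    · subst h1
      rw [wordHeight_swapLetters_of_le le_rfl]
      exact h.2.2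
    by_cases h2 : j = i + 1
    · rw [h2, swapLetters_right, h.1] at hj
      exact absurd hj (by simp)
    rw [swapLetters_of_ne h1 h2] at hj
    rw [h.wordHeight_swapLetters_of_ne h2]
    exact hf.one_le j hj
  tail j hj := by
    have := hf.lt h.2.1
    rw [swapLetters_of_ne (by omega) (by omega)]
    exact hf.tail j hj

/-- Peaks that are apart do not influence each other. -/
theorem IsPeak.swapLetters (h : IsPeak f i) (hj : IsPeak f j) (hij : i + 2 ≤ j ∨ j + 2 ≤ i) :
    IsPeak (swapLetters f i) j := by
  refine ⟨?_, ?_, ?_⟩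
  · rw [swapLetters_of_ne (by omega) (by omega)]; exact hj.1
  · rw [swapLetters_of_ne (by omega) (by omega)]; exact hj.2.1
  · rw [h.wordHeight_swapLetters_of_ne (by omega)]; exact hj.2.2

theorem IsPeak.apart (h : IsPeak f i) (hj : IsPeak f j) : i = j ∨ i + 2 ≤ j ∨ j + 2 ≤ i := by
  obtain ⟨h1, h2, -⟩ := h
  obtain ⟨h3, h4, -⟩ := hj
  by_cases e1 : j = i + 1
  · subst e1; simp_all
  by_cases e2 : i = j + 1
  · subst e2; simp_all
  omega

theorem wordHeight_moveToFront_two : wordHeight (moveToFront f i) 2 = 0 := by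
  simp [wordHeight, moveToFront]

theorem wordHeight_moveToFront_of_le (h : k ≤ i) :
    wordHeight (moveToFront f i) (k + 2) = wordHeight f k := by
  -- The initial `()` returns to height zero. The comparison word agrees with `f` below `i` and then
  -- copies the shifted word, so that the shift lemma applies to all letters.
  have e : wordHeight (moveToFront f i) (2 + k) =
      wordHeight (fun j => if j < i then f j else moveToFront f i (2 + j)) (0 + k) := by
    refine wordHeight_add _ _ wordHeight_moveToFront_two (fun j => ?_) k
    simp only [moveToFront]
    grind
  rw [add_comm, e, zero_add]
  exact wordHeight_congr fun j hj => if_pos (by omega)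

theorem wordHeight_moveToFront_of_ge (h1 : f i = false) (h2 : f (i + 1) = true)
    (h3 : 1 ≤ wordHeight f i) (h : i + 2 ≤ k) :
    wordHeight (moveToFront f i) k = wordHeight f k := by
  obtain ⟨l, rfl⟩ := Nat.exists_eq_add_of_le h
  refine wordHeight_add _ _ ?_ (fun j => ?_) l
  · rw [wordHeight_moveToFront_of_le le_rfl, wordHeight_succ_of_true (k := i + 1) h2,
      wordHeight_succ_of_false h1]
    omega
  · simp only [moveToFront]
    grind

theorem IsWord.moveToFront (hf : IsWord n f) (h1 : f i = false) (h2 : f (i + 1) = true)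
    (hi : i + 1 < n) : IsWord n (moveToFront f i) where
  one_le j hj := by
    rcases Nat.lt_or_ge j (i + 2) with h | h
    · match j with
      | 0 => simp [TemperleyLieb.moveToFront] at hj
      | 1 => simp [wordHeight, TemperleyLieb.moveToFront]
      | j + 2 =>
        rw [wordHeight_moveToFront_of_le (by omega)]
        refine hf.one_le j ?_
        simpa [TemperleyLieb.moveToFront, show j < i by omega] using hj
    · rw [wordHeight_moveToFront_of_ge h1 h2 (hf.one_le i h1) h]
      refine hf.one_le j ?_
      simp only [TemperleyLieb.moveToFront] at hj
      grind
  tail j hj := by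
    simp only [TemperleyLieb.moveToFront]
    have := hf.tail j hj
    grind

/-- The effect of a box addition and of moving a valley to the front on the levels. -/
theorem IsPeak.levels (h : IsPeak f i) (hf : IsWord n f) :
    ∃ R, levels n f = (wordHeight f i + 1) ::ₘ R ∧
      levels n (TemperleyLieb.swapLetters f i) = wordHeight f i ::ₘ R ∧
      levels n (TemperleyLieb.moveToFront (TemperleyLieb.swapLetters f i) i) = 1 ::ₘ R := by
  obtain ⟨m, rfl⟩ := Nat.exists_eq_add_of_le (hf.lt h.2.1 : i + 2 ≤ n)
  let φ : (ℕ → Bool) → ℕ → Multiset ℕ := fun f j => if f j then 0 else {wordHeight f j}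
  set g := TemperleyLieb.swapLetters f i with hg
  have g1 : g i = false := swapLetters_left.trans h.2.1
  have g2 : g (i + 1) = true := swapLetters_right.trans h.1
  have g3 : wordHeight g i = wordHeight f i := wordHeight_swapLetters_of_le le_rfl
  -- `R` collects the levels of all letters except `i` and `i+1`; neither operation changes the
  -- height of those letters.
  refine ⟨∑ j ∈ Finset.range i, φ f j + ∑ j ∈ Finset.range m, φ f (i + 2 + j), ?_, ?_, ?_⟩
  · have e1 : φ f i = 0 := if_pos h.1
    have e2 : φ f (i + 1) = {wordHeight f i + 1} := by
      simp [φ, h.2.1, wordHeight_succ_of_true h.1]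
    change ∑ j ∈ Finset.range (i + 2 + m), φ f j = _
    rw [Finset.sum_range_add, Finset.sum_range_succ, Finset.sum_range_succ, e1, e2,
      ← Multiset.singleton_add]
    abel
  · have e1 : φ g i = {wordHeight f i} := by simp [φ, g1, g3]
    have e2 : φ g (i + 1) = 0 := if_pos g2
    have e3 : ∀ j ∈ Finset.range i, φ g j = φ f j := by
      intro j hj
      rw [Finset.mem_range] at hj
      simp only [φ, hg, swapLetters_of_ne (f := f) (i := i) (j := j) (by omega) (by omega),
        wordHeight_swapLetters_of_le hj.le]
    have e4 : ∀ j ∈ Finset.range m, φ g (i + 2 + j) = φ f (i + 2 + j) := by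
      intro j _
      simp only [φ, hg, swapLetters_of_ne (f := f) (i := i) (j := i + 2 + j) (by omega) (by omega),
        h.wordHeight_swapLetters (k := i + 2 + j) (by omega)]
    change ∑ j ∈ Finset.range (i + 2 + m), φ g j = _
    rw [Finset.sum_range_add, Finset.sum_range_succ, Finset.sum_range_succ, e1, e2,
      ← Multiset.singleton_add, Finset.sum_congr rfl e3, Finset.sum_congr rfl e4]
    abel
  · have e1 : φ (moveToFront g i) 0 = 0 := if_pos rfl
    have e2 : φ (moveToFront g i) 1 = {1} := by simp [φ, moveToFront, wordHeight]
    have e3 : ∀ j ∈ Finset.range i, φ (moveToFront g i) (0 + 1 + 1 + j) = φ f j := by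
      intro j hj
      rw [Finset.mem_range] at hj
      have a1 : moveToFront g i (0 + 1 + 1 + j) = f j := by
        rw [← swapLetters_of_ne (f := f) (i := i) (j := j) (by omega) (by omega)]
        simp only [moveToFront]
        grind
      have a2 : wordHeight (moveToFront g i) (0 + 1 + 1 + j) = wordHeight f j := by
        rw [show 0 + 1 + 1 + j = j + 2 by omega, wordHeight_moveToFront_of_le hj.le,
          wordHeight_swapLetters_of_le hj.le]
      simp only [φ, a1, a2]
    have e4 : ∀ j ∈ Finset.range m, φ (moveToFront g i) (0 + 1 + 1 + i + j) = φ f (i + 2 + j) := by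
      intro j _
      have a1 : moveToFront g i (0 + 1 + 1 + i + j) = f (i + 2 + j) := by
        rw [← swapLetters_of_ne (f := f) (i := i) (j := i + 2 + j) (by omega) (by omega)]
        simp only [moveToFront]
        grind
      have a2 : wordHeight (moveToFront g i) (0 + 1 + 1 + i + j) = wordHeight f (i + 2 + j) := by
        rw [show 0 + 1 + 1 + i + j = i + 2 + j by omega, wordHeight_moveToFront_of_ge g1 g2
          (g3 ▸ h.2.2) (by omega), h.wordHeight_swapLetters (by omega)]
      simp only [φ, a1, a2]
    change ∑ j ∈ Finset.range (i + 2 + m), φ (moveToFront g i) j = _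
    rw [show i + 2 + m = 0 + 1 + 1 + i + m by omega, Finset.sum_range_add, Finset.sum_range_add,
      Finset.sum_range_succ, Finset.sum_range_succ, Finset.sum_range_zero, e1, e2,
      ← Multiset.singleton_add, Finset.sum_congr rfl e3, Finset.sum_congr rfl e4]
    abel

/-- A closing bracket above height one is preceded by an opening one, which makes a peak, or by a
closing one at a still greater height, to which the induction applies. -/
theorem levels_eq_one_iff (hf : IsWord n f) :
    (∀ x ∈ levels n f, x = 1) ↔ ∀ i, ¬ IsPeak f i := by
  constructor
  · intro h i hi
    have h1 := h _ (hf.mem_levels hi.2.1)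
    rw [wordHeight_succ_of_true hi.1] at h1
    have := hi.2.2
    omega
  · intro h x hx
    obtain ⟨j, -, hj, rfl⟩ := mem_levels.1 hx
    induction j with
    | zero => exact absurd (hf.one_le 0 hj) (by simp [wordHeight])
    | succ j ih =>
      cases hfj : f j with
      | true =>
        have := h j
        rw [wordHeight_succ_of_true hfj]
        simp only [IsPeak, hfj, hj, true_and] at this
        omega
      | false =>
        have h1 := ih hfj (hf.mem_levels hfj)
        have h2 := hf.one_le _ hj
        rw [wordHeight_succ_of_false hfj] at h2
        omega

theorem IsFirstPeak.wordHeight (h : IsFirstPeak f i) (hk : k ≤ i + 1) : wordHeight f k = k := by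
  induction k with
  | zero => rfl
  | succ k ih => rw [wordHeight_succ_of_true (h.1 k (by omega)), ih (by omega)]

theorem IsFirstPeak.wordHeight_deleteLetters (h : IsFirstPeak f i) (hk : i ≤ k) :
    TemperleyLieb.wordHeight (deleteLetters f i) k = TemperleyLieb.wordHeight f (k + 2) := by
  obtain ⟨l, rfl⟩ := Nat.exists_eq_add_of_le hk
  rw [show i + l + 2 = i + 2 + l by omega]
  refine wordHeight_add _ _ ?_ (fun j => ?_) l
  · rw [wordHeight_succ_of_false (k := i + 1) h.2, h.wordHeight le_rfl,
      wordHeight_congr (f := deleteLetters f i) (g := f) fun j hj => if_pos hj, h.wordHeight (by omega)]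
    rfl
  · rw [deleteLetters, if_neg (by omega)]
    congr 1
    omega

theorem IsFirstPeak.isWord_deleteLetters (h : IsFirstPeak f i) (hf : IsWord (n + 2) f) :
    IsWord n (deleteLetters f i) where
  one_le j hj := by
    rw [deleteLetters] at hj
    split_ifs at hj with hji
    · rw [h.1 j hji.le] at hj
      exact absurd hj (by simp)
    · rw [h.wordHeight_deleteLetters (by omega)]
      exact hf.one_le _ hj
  tail j hj := by
    have := hf.lt h.2
    rw [deleteLetters, if_neg (by omega)]
    exact hf.tail _ (by omega)

theorem IsFirstPeak.isWord (h : IsFirstPeak f i) (hi : i ≤ n)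
    (hf : IsWord n (deleteLetters f i)) : IsWord (n + 2) f where
  one_le j hj := by
    by_cases h1 : j ≤ i + 1
    · rw [h.wordHeight h1]
      by_contra h0
      rw [h.1 j (by omega)] at hj
      exact absurd hj (by simp)
    · obtain ⟨k, rfl⟩ := Nat.exists_eq_add_of_le' (by omega : 2 ≤ j)
      rw [← h.wordHeight_deleteLetters (by omega)]
      refine hf.one_le k ?_
      rw [deleteLetters, if_neg (by omega), hj]
  tail j hj := by
    obtain ⟨k, rfl⟩ := Nat.exists_eq_add_of_le' (by omega : 2 ≤ j)
    rw [← hf.tail k (by omega), deleteLetters, if_neg (by omega)]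

/-- This matches the recursion of `restrictedSequence`: nothing closes before the first peak, the
peak closes at height `i+1`, and deleting it preserves the later heights. -/
theorem IsFirstPeak.levels (h : IsFirstPeak f i) (hi : i ≤ n) :
    levels (n + 2) f = (i + 1) ::ₘ levels n (deleteLetters f i) := by
  obtain ⟨m, rfl⟩ := Nat.exists_eq_add_of_le hi
  unfold TemperleyLieb.levels
  have e1 : ∀ j ∈ Finset.range i,
      (if f j then 0 else {TemperleyLieb.wordHeight f j} : Multiset ℕ) = 0 :=
    fun j hj => if_pos (h.1 j (Finset.mem_range.1 hj).le)
  have e2 : ∀ j ∈ Finset.range i, (if deleteLetters f i j then 0 else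
      {TemperleyLieb.wordHeight (deleteLetters f i) j} : Multiset ℕ) = 0 := by
    intro j hj
    rw [if_pos]
    rw [deleteLetters, if_pos (Finset.mem_range.1 hj)]
    exact h.1 j (Finset.mem_range.1 hj).le
  rw [show i + m + 2 = i + 2 + m by omega, Finset.sum_range_add, Finset.sum_range_add _ i m,
    Finset.sum_range_succ, Finset.sum_range_succ, Finset.sum_eq_zero e1, Finset.sum_eq_zero e2,
    if_pos (h.1 i le_rfl), h.2, h.wordHeight le_rfl]
  simp only [Bool.false_eq_true, if_false, zero_add, Multiset.singleton_add]
  congr 1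
  refine Finset.sum_congr rfl fun j _ => ?_
  rw [h.wordHeight_deleteLetters (by omega), deleteLetters, if_neg (show ¬ i + j < i by omega),
    show i + j + 2 = i + 2 + j by omega]

theorem exists_isFirstPeak (h0 : f 0 = true) (h : ∃ j, f j = false) : ∃ i, IsFirstPeak f i := by
  have hne : Nat.find h ≠ 0 := by
    intro h1
    have := Nat.find_spec h
    rw [h1, h0] at this
    exact absurd this (by simp)
  obtain ⟨i, hi⟩ := Nat.exists_eq_succ_of_ne_zero hne
  refine ⟨i, fun j hj => ?_, by rw [← Nat.succ_eq_add_one, ← hi]; exact Nat.find_spec h⟩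
  have := Nat.find_min h (m := j) (by omega)
  simpa using this

end Words

namespace HalfDiagram

/-! ### The bracket word of a half-diagram -/

variable {n : ℕ}

open Classical in
/-- The bracket word of a half-diagram. -/
noncomputable def word (a : HalfDiagram n) (j : ℕ) : Bool :=
  if h : j < n then decide (¬ a.IsClosing ⟨j, h⟩) else true

theorem word_eq_false {a : HalfDiagram n} {j : ℕ} :
    a.word j = false ↔ ∃ h : j < n, a.IsClosing ⟨j, h⟩ := by
  unfold word
  split_ifs with h <;> simp [h]

theorem word_eq_true {a : HalfDiagram n} {j : ℕ} :
    a.word j = true ↔ ∀ h : j < n, ¬ a.IsClosing ⟨j, h⟩ := by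
  rw [← Bool.not_eq_false, word_eq_false, not_exists]

/-- If the partner of `i+1` were further left, `i` would lie under that arch. Its partner would lie
there too, hence to the left of `i`, making the bracket at `i` closing. -/
theorem hasArch_of_word {a : HalfDiagram n} {i : ℕ} (h1 : a.word i = true)
    (h2 : a.word (i + 1) = false) : a.HasArch i := by
  obtain ⟨hi, h⟩ := word_eq_false.1 h2
  have h' := word_eq_true.1 h1 (by omega)
  refine ⟨hi, ?_⟩
  simp only [IsClosing] at h h'
  by_contra hne
  have k1 := a.partner_partner ⟨i + 1, hi⟩
  have k2 : a.partner ⟨i + 1, hi⟩ ≠ ⟨i, by omega⟩ := fun e => hne (by rw [← k1, e])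
  have k3 : a.partner ⟨i + 1, hi⟩ < ⟨i, by omega⟩ := by
    refine lt_of_le_of_ne ?_ k2
    rw [Fin.lt_def] at h
    rw [Fin.le_def]
    simp only at h ⊢
    omega
  obtain ⟨-, h3, h4⟩ := a.partner_inside k3 (by rw [k1, Fin.lt_def]; simp)
  rw [k1] at h3
  refine h' (lt_of_le_of_ne ?_ h4)
  rw [Fin.lt_def] at h3
  rw [Fin.le_def]
  simp only at h3 ⊢
  omega

theorem HasArch.word {a : HalfDiagram n} {i : ℕ} (h : a.HasArch i) :
    a.word i = true ∧ a.word (i + 1) = false := by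
  obtain ⟨hi, h⟩ := h
  have h' : a.partner ⟨i + 1, hi⟩ = ⟨i, by omega⟩ := by rw [← h, a.partner_partner]
  refine ⟨word_eq_true.2 fun _ => ?_, word_eq_false.2 ⟨hi, ?_⟩⟩
  · simp [IsClosing, h]
  · simp [IsClosing, h']

/-- Otherwise `b.partner j` lies under the arch of `a` ending at `j`. As an opening point it is
closed in `a` at some `k < j`; by hypothesis `b` agrees at `k`, so `b` would pair one point with
both `k` and `j`. -/
theorem not_partner_lt {a b : HalfDiagram n} (h : ∀ k, a.IsClosing k ↔ b.IsClosing k) {j : Fin n}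
    (hj : b.IsClosing j) (ih : ∀ k < j, a.IsClosing k → a.partner k = b.partner k) :
    ¬ a.partner j < b.partner j := by
  intro hlt
  have h1 := a.partner_inside hlt (by rw [a.partner_partner]; exact hj)
  rw [a.partner_partner] at h1
  obtain ⟨-, h2, h3⟩ := h1
  have h4 : ¬ a.IsClosing (b.partner j) := by
    rw [h, IsClosing, b.partner_partner]
    exact hj.asymm
  have h5 : b.partner j < a.partner (b.partner j) :=
    lt_of_le_of_ne (not_lt.1 h4) h3.symm
  have h6 := ih _ h2 (by rwa [IsClosing, a.partner_partner])
  rw [a.partner_partner] at h6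
  exact h2.ne (b.partner_injective h6).symm

theorem word_injective : Function.Injective (word : HalfDiagram n → ℕ → Bool) := by
  intro a b hab
  have key : ∀ k, a.IsClosing k ↔ b.IsClosing k := by
    intro k
    have h1 := word_eq_false (a := a) (j := k.1)
    rw [hab, word_eq_false] at h1
    simpa using h1.symm
  have hcl : ∀ j, a.IsClosing j → a.partner j = b.partner j := by
    intro j
    induction j using WellFoundedLT.induction with | _ j ih => ?_
    intro hj
    refine le_antisymm (not_lt.1 (not_partner_lt (fun k => (key k).symm) hj fun k hk hk' => ?_))
      (not_lt.1 (not_partner_lt key ((key j).1 hj) ih))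
    exact (ih k hk ((key k).2 hk')).symm
  ext j : 2
  by_cases hj : a.IsClosing j
  · exact hcl j hj
  have hj' := mt (key j).2 hj
  rcases (not_lt.1 hj).lt_or_eq with h | h
  · have := hcl (a.partner j) (by rwa [IsClosing, a.partner_partner])
    rw [a.partner_partner] at this
    conv_rhs => rw [this]
    rw [b.partner_partner]
  rcases (not_lt.1 hj').lt_or_eq with h' | h'
  · have := hcl (b.partner j) (by rwa [key, IsClosing, b.partner_partner])
    rw [b.partner_partner] at this
    conv_lhs => rw [← this]
    rw [a.partner_partner]
  · rw [← h, ← h']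

theorem word_removeArch (a : HalfDiagram (n + 2)) {i : ℕ} (h : a.HasArch i) :
    (a.removeArch i h).word = deleteLetters a.word i := by
  have key : ∀ j : Fin n, (a.removeArch i h).IsClosing j ↔ a.IsClosing (skip i j) := by
    intro j
    rw [IsClosing, IsClosing, ← skip_removePartner a i h, skip_lt_skip]
    rfl
  have hi := h.1
  ext j
  rw [Bool.eq_iff_iff, word_eq_true, deleteLetters]
  split_ifs with hji
  · rw [word_eq_true]
    have hj : j < n := by omega
    simp only [hj, show j < n + 2 by omega, forall_true_left, key, skip, hji, if_true]
  · rw [word_eq_true]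
    simp only [Nat.add_lt_add_iff_right, key, skip, hji, if_false]

theorem isFirstPeak_of_hasArch {a : HalfDiagram n} {i : ℕ} (h : a.HasArch i)
    (hmin : ∀ j < i, ¬ a.HasArch j) : IsFirstPeak a.word i := by
  refine ⟨fun j => ?_, h.word.2⟩
  induction j with
  | zero =>
    intro _
    refine word_eq_true.2 fun _ => ?_
    simp [IsClosing, Fin.lt_def]
  | succ j ih =>
    intro hj
    by_contra hne
    exact hmin j (by omega) (hasArch_of_word (ih (by omega)) (by simpa using hne))

theorem exists_hasArch {a : HalfDiagram n} (h : ∃ j, a.word j = false) : ∃ i, a.HasArch i := by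
  have h0 : a.word 0 = true := word_eq_true.2 fun _ => by simp [IsClosing, Fin.lt_def]
  obtain ⟨i, hi⟩ := exists_isFirstPeak h0 h
  exact ⟨i, hasArch_of_word (hi.1 i le_rfl) hi.2⟩

theorem word_eq_true_of_not_hasArch {a : HalfDiagram n} (h : ¬ ∃ i, a.HasArch i) (j : ℕ) :
    a.word j = true := by
  by_contra hj
  exact h (exists_hasArch ⟨j, by simpa using hj⟩)

-- The leftmost innermost arch is the first peak of the word, so both assertions are inherited from
-- the diagram with this arch removed.
open Classical in
theorem isWord_and_restrictedSequence {n : ℕ} (a : HalfDiagram n) :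
    IsWord n a.word ∧ (a.restrictedSequence : Multiset ℕ) = levels n a.word := by
  induction n using Nat.strong_induction_on with | _ n ih => ?_
  by_cases h : ∃ i, a.HasArch i
  · have hp := isFirstPeak_of_hasArch (Nat.find_spec h) fun j hj => Nat.find_min h hj
    obtain ⟨hi, -⟩ := Nat.find_spec h
    match n, a with
    | 0, _ => omega
    | 1, _ => omega
    | n + 2, a =>
      obtain ⟨h1, h2⟩ := ih n (by omega) (a.removeArch (Nat.find h) (Nat.find_spec h))
      rw [word_removeArch] at h1 h2
      refine ⟨hp.isWord (by omega) h1, ?_⟩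
      rw [hp.levels (by omega), ← h2, restrictedSequence, dif_pos h, Multiset.cons_coe]
  · have hw := word_eq_true_of_not_hasArch h
    refine ⟨⟨fun j hj => by simp [hw] at hj, fun j _ => hw j⟩, ?_⟩
    have hr : a.restrictedSequence = [] := by
      match n, a with
      | 0, _ => rfl
      | 1, _ => rfl
      | n + 2, a => rw [restrictedSequence, dif_neg h]
    rw [hr, levels]
    simp [hw]

theorem isWord_word (a : HalfDiagram n) : IsWord n a.word := (isWord_and_restrictedSequence a).1

theorem coe_restrictedSequence (a : HalfDiagram n) :
    (a.restrictedSequence : Multiset ℕ) = levels n a.word := (isWord_and_restrictedSequence a).2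

theorem isMinimal_iff (a : HalfDiagram n) : a.IsMinimal ↔ ∀ i, ¬ IsPeak a.word i := by
  rw [← levels_eq_one_iff a.isWord_word, ← coe_restrictedSequence]
  rfl

theorem height_eq (a : HalfDiagram n) {k : ℕ} (hk : k ≤ n) : a.height k = wordHeight a.word k := by
  classical
  have step : ∀ (P : Fin n → Prop) [DecidablePred P] (k : ℕ) (hk : k < n),
      (Finset.univ.filter fun j : Fin n => j.1 < k + 1 ∧ P j).card =
        (Finset.univ.filter fun j : Fin n => j.1 < k ∧ P j).card + if P ⟨k, hk⟩ then 1 else 0 := by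
    intro P _ k hk
    split_ifs with h
    · rw [← Finset.card_insert_of_notMem (a := (⟨k, hk⟩ : Fin n)) (by simp)]
      congr 1
      ext j
      simp only [Finset.mem_filter, Finset.mem_univ, true_and, Finset.mem_insert, Fin.ext_iff]
      constructor
      · rintro ⟨h1, h2⟩
        rcases Nat.lt_succ_iff_lt_or_eq.1 h1 with h3 | h3
        · exact Or.inr ⟨h3, h2⟩
        · exact Or.inl h3
      · rintro (h1 | ⟨h1, h2⟩)
        · exact ⟨by omega, by rwa [show j = ⟨k, hk⟩ from Fin.ext h1]⟩
        · exact ⟨by omega, h2⟩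
    · rw [add_zero]
      congr 1
      ext j
      simp only [Finset.mem_filter, Finset.mem_univ, true_and]
      constructor
      · rintro ⟨h1, h2⟩
        refine ⟨lt_of_le_of_ne (Nat.lt_succ_iff.1 h1) fun h3 => h ?_, h2⟩
        rwa [show (⟨k, hk⟩ : Fin n) = j from Fin.ext h3.symm]
      · rintro ⟨h1, h2⟩
        exact ⟨by omega, h2⟩
  -- The additive form of the claim avoids truncated subtraction.
  have key : (Finset.univ.filter fun j : Fin n => j.1 < k ∧ ¬ a.IsClosing j).card =
      (Finset.univ.filter fun j : Fin n => j.1 < k ∧ a.IsClosing j).card + wordHeight a.word k := by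
    induction k with
    | zero => simp [wordHeight]
    | succ k ih =>
      have ih := ih (by omega)
      rw [step (fun j => ¬ a.IsClosing j) k (by omega), step _ k (by omega), ih]
      by_cases h : a.IsClosing ⟨k, by omega⟩
      · have hf : a.word k = false := word_eq_false.2 ⟨_, h⟩
        have := a.isWord_word.one_le k hf
        rw [wordHeight_succ_of_false hf, if_pos h, if_neg (not_not.2 h)]
        omega
      · have hf : a.word k = true := word_eq_true.2 fun _ => h
        rw [wordHeight_succ_of_true hf, if_neg h, if_pos h]
        omega
  rw [height, ← Nat.sub_eq_of_eq_add' key]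

/-- The height condition in `IsPeak` says that, after the swap, the closing bracket at `i` has
something to close. -/
theorem isBoxAddition_iff {a b : HalfDiagram n} {i : ℕ} (hi : i + 1 < n) :
    IsBoxAddition i hi a b ↔ IsPeak b.word i ∧ a.word = swapLetters b.word i := by
  constructor
  · rintro ⟨h1, h2, h3, h4, h5⟩
    have e : a.word = swapLetters b.word i := by
      ext j
      rw [Bool.eq_iff_iff, swapLetters]
      split_ifs with e1 e2
      · subst e1
        rw [word_eq_true, word_eq_true]
        simp only [show j < n by omega, hi, forall_true_left, h1, h4]
      · subst e2
        rw [word_eq_true, word_eq_true]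
        simp only [show i < n by omega, hi, forall_true_left, h2, h3]
      · rw [word_eq_true, word_eq_true]
        exact forall_congr' fun hj => not_congr (h5 _ e1 e2).symm
    refine ⟨⟨word_eq_true.2 fun _ => h3, word_eq_false.2 ⟨_, h4⟩, ?_⟩, e⟩
    rw [← wordHeight_swapLetters_of_le (i := i) le_rfl, ← e]
    exact a.isWord_word.one_le i (word_eq_false.2 ⟨_, h1⟩)
  · rintro ⟨⟨h1, h2, -⟩, e⟩
    have key : ∀ (c : HalfDiagram n) (j : Fin n), c.IsClosing j ↔ c.word j.1 = false := by
      intro c j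
      rw [word_eq_false]
      simp
    simp only [IsBoxAddition, key, e, swapLetters_left, swapLetters_right, h1, h2]
    refine ⟨trivial, by simp, by simp, trivial, fun j h3 h4 => ?_⟩
    rw [swapLetters_of_ne h3 h4]

/-! ### Insertion of arches: realizing bracket words by half-diagrams -/

theorem eq_skip_of_ne {i : ℕ} (hi : i ≤ n) (k : Fin (n + 2)) (h1 : k.1 ≠ i) (h2 : k.1 ≠ i + 1) :
    ∃ j : Fin n, k = skip i j := by
  refine ⟨⟨unskip i k.1, ?_⟩, (skip_unskip k h1 h2 _).symm⟩
  unfold unskip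
  split_ifs <;> omega

/-- The partner function after insertion of an arch. -/
def insertPartner (a : HalfDiagram n) (i : ℕ) (hi : i ≤ n) (k : Fin (n + 2)) : Fin (n + 2) :=
  if h1 : k.1 = i then ⟨i + 1, by omega⟩
  else if h2 : k.1 = i + 1 then ⟨i, by omega⟩
  else skip i (a.partner ⟨unskip i k.1, by unfold unskip; split_ifs <;> omega⟩)

theorem insertPartner_skip (a : HalfDiagram n) {i : ℕ} (hi : i ≤ n) (j : Fin n) :
    a.insertPartner i hi (skip i j) = skip i (a.partner j) := by
  have h1 : (skip i j).1 ≠ i := by simp only [skip]; split_ifs <;> omega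
  have h2 : (skip i j).1 ≠ i + 1 := by simp only [skip]; split_ifs <;> omega
  rw [insertPartner, dif_neg h1, dif_neg h2]
  congr 2
  exact skip_injective i (skip_unskip _ h1 h2 _)

theorem insertPartner_inside (a : HalfDiagram n) {i : ℕ} (hi : i ≤ n) {j k : Fin (n + 2)}
    (h1 : j < k) (h2 : k < a.insertPartner i hi j) :
    a.insertPartner i hi k < a.insertPartner i hi j ∧ a.insertPartner i hi k ≠ k := by
  by_cases j1 : j.1 = i
  · rw [insertPartner, dif_pos j1] at h2
    simp only [Fin.lt_def] at h1 h2
    omega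
  by_cases j2 : j.1 = i + 1
  · rw [insertPartner, dif_neg j1, dif_pos j2] at h2
    simp only [Fin.lt_def] at h1 h2
    omega
  obtain ⟨j, rfl⟩ := eq_skip_of_ne hi j j1 j2
  rw [insertPartner_skip] at h2 ⊢
  have h3 : (skip i (a.partner j)).1 ≠ i ∧ (skip i (a.partner j)).1 ≠ i + 1 := by
    simp only [skip]
    constructor <;> split_ifs <;> omega
  simp only [Fin.lt_def] at h1 h2
  by_cases k1 : k.1 = i
  · rw [insertPartner, dif_pos k1]
    simp only [Fin.lt_def, ne_eq, Fin.ext_iff]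
    omega
  by_cases k2 : k.1 = i + 1
  · rw [insertPartner, dif_neg k1, dif_pos k2]
    simp only [Fin.lt_def, ne_eq, Fin.ext_iff]
    omega
  obtain ⟨k, rfl⟩ := eq_skip_of_ne hi k k1 k2
  rw [insertPartner_skip, skip_lt_skip, (skip_injective i).ne_iff]
  exact (a.partner_inside (skip_lt_skip.1 h1) (skip_lt_skip.1 h2)).2

/-- Insert an arch joining the new points with values `i` and `i + 1`. -/
def insertArch (a : HalfDiagram n) (i : ℕ) (hi : i ≤ n) : HalfDiagram (n + 2) where
  partner := a.insertPartner i hi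
  partner_partner k := by
    by_cases k1 : k.1 = i
    · ext
      simp [insertPartner, k1]
    by_cases k2 : k.1 = i + 1
    · ext
      simp [insertPartner, k2]
    obtain ⟨k, rfl⟩ := eq_skip_of_ne hi k k1 k2
    rw [insertPartner_skip, insertPartner_skip, a.partner_partner]
  noncrossing j k := fun ⟨h1, h2, h3⟩ => ((a.insertPartner_inside hi h1 h2).1.trans h3).false
  noncrossing_through j k := fun ⟨h1, h2, h3⟩ => (a.insertPartner_inside hi h1 h2).2 h3

theorem removeArch_insertArch (a : HalfDiagram n) {i : ℕ} (hi : i ≤ n)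
    (h : (a.insertArch i hi).HasArch i) : (a.insertArch i hi).removeArch i h = a := by
  ext j : 2
  apply skip_injective i
  exact (skip_removePartner _ i h j).trans (a.insertPartner_skip hi j)

theorem hasArch_insertArch (a : HalfDiagram n) {i : ℕ} (hi : i ≤ n) :
    (a.insertArch i hi).HasArch i := ⟨by omega, by simp [insertArch, insertPartner]⟩

/-- Every bracket word with nonnegative heights belongs to a half-diagram. -/
theorem exists_word_eq {n : ℕ} {f : ℕ → Bool} (hf : IsWord n f) :
    ∃ a : HalfDiagram n, a.word = f := by
  induction n using Nat.strong_induction_on generalizing f with | _ n ih => ?_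
  by_cases h : ∃ j, f j = false
  · have h0 : f 0 = true := by
      by_contra h0
      have := hf.one_le 0 (by simpa using h0)
      simp [wordHeight] at this
    obtain ⟨i, hi⟩ := exists_isFirstPeak h0 h
    have hin := hf.lt hi.2
    obtain ⟨m, rfl⟩ := Nat.exists_eq_add_of_le' (by omega : 2 ≤ n)
    obtain ⟨a, ha⟩ := ih m (by omega) (hi.isWord_deleteLetters hf)
    have harch := a.hasArch_insertArch (i := i) (by omega)
    refine ⟨a.insertArch i (by omega), ?_⟩
    have hd : deleteLetters (a.insertArch i (by omega)).word i = deleteLetters f i := by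
      rw [← word_removeArch _ harch, removeArch_insertArch, ha]
    ext j
    rcases Nat.lt_or_ge j i with h1 | h1
    · have := congrFun hd j
      rwa [deleteLetters, deleteLetters, if_pos h1, if_pos h1] at this
    obtain ⟨l, rfl⟩ := Nat.exists_eq_add_of_le h1
    match l with
    | 0 => exact harch.word.1.trans (hi.1 _ le_rfl).symm
    | 1 => exact harch.word.2.trans hi.2.symm
    | l + 2 =>
      have := congrFun hd (i + l)
      rwa [deleteLetters, deleteLetters, if_neg (by omega), if_neg (by omega)] at this
  · refine ⟨⟨id, fun _ => rfl, fun i k h => (h.1.trans h.2.1).false,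
      fun i k h => (h.1.trans h.2.1).false⟩, ?_⟩
    ext j
    rw [Bool.eq_iff_iff, word_eq_true]
    simp only [IsClosing, id, lt_irrefl, not_false_eq_true, implies_true, true_iff]
    by_contra hj
    exact h ⟨j, by simpa using hj⟩

end HalfDiagram

/-! ### The Temperley-Lieb relations -/

section Generators

variable {n : ℕ}

/-- The action of `e_{i+1}` (zero if `i` is out of range). -/
noncomputable def genOp (q : ℝ) (n i : ℕ) : U n →ₗ[ℂ] U n :=
  if hi : i + 1 < n then act q (gen n i hi) else 0

theorem genOp_eq (q : ℝ) {i : ℕ} (hi : i + 1 < n) :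
    genOp q n i = HalfDiagram.joinOp q i hi := by
  rw [genOp, dif_pos hi, act_gen]

theorem genOp_sq (q : ℝ) (i : ℕ) (v : U n) :
    genOp q n i (genOp q n i v) = (q : ℂ) • genOp q n i v := by
  by_cases hi : i + 1 < n
  · rw [genOp_eq q hi]
    exact LinearMap.congr_fun (HalfDiagram.joinOp_sq q i hi) v
  · simp [genOp, hi]

theorem genOp_comm_of_le (q : ℝ) {i j : ℕ} (hij : i + 2 ≤ j) (v : U n) :
    genOp q n i (genOp q n j v) = genOp q n j (genOp q n i v) := by
  by_cases hj : j + 1 < n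
  · rw [genOp_eq q hj, genOp_eq q (show i + 1 < n by omega)]
    have h := HalfDiagram.joinOp_comm q (show i + 1 < n by omega) hj hij
    exact LinearMap.congr_fun h v
  · simp [genOp, hj]

theorem genOp_comm (q : ℝ) {i j : ℕ} (hij : i + 2 ≤ j ∨ j + 2 ≤ i) (v : U n) :
    genOp q n i (genOp q n j v) = genOp q n j (genOp q n i v) := by
  rcases hij with h | h
  · exact genOp_comm_of_le q h v
  · exact (genOp_comm_of_le q h v).symm

theorem genOp_up (q : ℝ) {i : ℕ} (hi : i + 2 < n) (v : U n) :
    genOp q n i (genOp q n (i + 1) (genOp q n i v)) = genOp q n i v := by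
  rw [genOp_eq q (show i + 1 < n by omega), genOp_eq q hi]
  exact LinearMap.congr_fun (HalfDiagram.joinOp_up q i hi) v

theorem genOp_down (q : ℝ) {i : ℕ} (hi : i + 2 < n) (v : U n) :
    genOp q n (i + 1) (genOp q n i (genOp q n (i + 1) v)) = genOp q n (i + 1) v := by
  rw [genOp_eq q (show i + 1 < n by omega), genOp_eq q hi]
  exact LinearMap.congr_fun (HalfDiagram.joinOp_down q i hi) v

theorem formMap_genOp {q : ℝ} (hq : q ≠ 0) (i : ℕ) (v w : U n) :
    formMap q (genOp q n i v) w = formMap q v (genOp q n i w) := by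
  by_cases hi : i + 1 < n
  · rw [genOp_eq q hi, formMap_joinOp hq]
  · simp [genOp, hi]

/-- The product `e_1 ⋯ e_i`. -/
noncomputable def genProd (q : ℝ) (n : ℕ) : ℕ → U n →ₗ[ℂ] U n
  | 0 => LinearMap.id
  | i + 1 => genProd q n i ∘ₗ genOp q n i

theorem genProd_succ (q : ℝ) (i : ℕ) (v : U n) :
    genProd q n (i + 1) v = genProd q n i (genOp q n i v) := rfl

theorem genOp_genProd (q : ℝ) {j k : ℕ} (h : j + 1 ≤ k) (v : U n) :
    genOp q n k (genProd q n j v) = genProd q n j (genOp q n k v) := by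
  induction j generalizing v with
  | zero => rfl
  | succ j ih => rw [genProd_succ, genProd_succ, ih (by omega), genOp_comm q (Or.inr h)]

theorem genProd_genOp_pred (q : ℝ) {k : ℕ} (h : k + 2 < n) (v : U n) :
    genProd q n (k + 2) (genOp q n k v) = genProd q n (k + 1) v := by
  rw [genProd_succ, genProd_succ, genOp_up q h, genProd_succ]

/-- As a diagram, the product moves strings to the left of its right-hand arch two places up, so a
generator acting on them passes through with its index raised by two. -/
theorem genProd_genOp (q : ℝ) {i j : ℕ} (h : j + 2 ≤ i) (hi : i + 1 < n) (v : U n) :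
    genProd q n (i + 1) (genOp q n j v) = genOp q n (j + 2) (genProd q n (i + 1) v) := by
  obtain ⟨k, rfl⟩ := Nat.exists_eq_add_of_le h
  induction k generalizing v with
  | zero =>
    -- For `i = j + 2` both sides reduce to `genProd q n j` applied to `genOp q n j (genOp q n (j +
    -- 2) v)`.
    simp only [add_zero, genProd_succ]
    rw [genOp_genProd q (k := j + 2) (by omega), genOp_comm q (i := j + 2) (j := j) (by omega) v,
      genOp_up q (by omega), genOp_comm q (i := j + 2) (j := j) (by omega),
      genOp_down q (i := j + 1) (by omega)]
  | succ k ih =>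
    rw [show j + 2 + (k + 1) = j + 2 + k + 1 by omega, genProd_succ q (j + 2 + k + 1),
      genProd_succ q (j + 2 + k + 1), genOp_comm q (j := j) (by omega),
      ih _ (by omega) (by omega)]

theorem formMap_genOp_self {q : ℝ} (hq : q ≠ 0) (i : ℕ) (v : U n) :
    formMap q (genOp q n i v) (genOp q n i v) = q * formMap q (genOp q n i v) v := by
  rw [← formMap_genOp hq, genOp_sq, map_smul, LinearMap.smul_apply, smul_eq_mul]

/-- Moving one outermost factor across the form produces `e_{i+1} e_i e_{i+1} = e_{i+1}`, so the
product telescopes to its last factor. -/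
theorem formMap_genProd_self {q : ℝ} (hq : q ≠ 0) {i : ℕ} (hi : i + 1 < n) (v : U n) :
    formMap q (genProd q n (i + 1) v) (genProd q n (i + 1) v) =
      q * formMap q (genOp q n i v) v := by
  induction i generalizing v with
  | zero => exact formMap_genOp_self hq 0 v
  | succ i ih =>
    rw [genProd_succ, ih (by omega), ← formMap_genOp hq (i + 1), genOp_down q hi]

end Generators

/-! ### The second basis, indexed by bracket words -/

section WordVec

variable {n : ℕ} {q : ℝ}

open Classical in
/-- The basis vector of the half-diagram with a given bracket word. -/
noncomputable def baseVec (n : ℕ) (f : ℕ → Bool) : U n :=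
  if h : ∃ a : HalfDiagram n, a.word = f then xi h.choose else 0

theorem baseVec_word (a : HalfDiagram n) : baseVec n a.word = xi a := by
  have h : ∃ b : HalfDiagram n, b.word = a.word := ⟨a, rfl⟩
  rw [baseVec, dif_pos h, HalfDiagram.word_injective h.choose_spec]

theorem IsPeak.sum_levels_lt {f : ℕ → Bool} {i : ℕ} (h : IsPeak f i) (hf : IsWord n f) :
    (TemperleyLieb.levels n (TemperleyLieb.swapLetters f i)).sum <
      (TemperleyLieb.levels n f).sum := by
  obtain ⟨R, h1, h2, -⟩ := h.levels hf
  rw [h1, h2, Multiset.sum_cons, Multiset.sum_cons]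
  omega

open Classical in
/-- The vector of the second basis that belongs to a bracket word. -/
noncomputable def wordVec (q : ℝ) (n : ℕ) (f : ℕ → Bool) : U n :=
  if h : IsWord n f ∧ ∃ i, IsPeak f i then
    genOp q n h.2.choose (wordVec q n (swapLetters f h.2.choose)) -
      ((mu q (wordHeight f h.2.choose) : ℝ) : ℂ) • wordVec q n (swapLetters f h.2.choose)
  else baseVec n f
termination_by (levels n f).sum
decreasing_by all_goals exact h.2.choose_spec.sum_levels_lt h.1

theorem wordVec_of_not_isPeak {f : ℕ → Bool} (h : ∀ i, ¬ IsPeak f i) :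
    wordVec q n f = baseVec n f := by
  rw [wordVec, dif_neg]
  rintro ⟨-, i, hi⟩
  exact h i hi

/-- The vector does not depend on the sequence of box additions. -/
theorem IsPeak.wordVec {f : ℕ → Bool} {i : ℕ} (h : IsPeak f i) (hf : IsWord n f) :
    wordVec q n f = genOp q n i (wordVec q n (TemperleyLieb.swapLetters f i)) -
      ((mu q (wordHeight f i) : ℝ) : ℂ) • wordVec q n (TemperleyLieb.swapLetters f i) := by
  induction hs : (TemperleyLieb.levels n f).sum using Nat.strong_induction_on generalizing f i with
    | _ s ih => ?_
  subst hs
  have hex : IsWord n f ∧ ∃ i, IsPeak f i := ⟨hf, i, h⟩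
  rw [TemperleyLieb.wordVec, dif_pos hex]
  have hj := hex.2.choose_spec
  generalize hex.2.choose = j at *
  -- Diamond argument: two different peaks survive each other's removal with unchanged heights, so
  -- both boxes can be peeled off in either order, and the two operators commute.
  rcases h.apart hj with rfl | hij
  · rfl
  have hij' : j + 2 ≤ i ∨ i + 2 ≤ j := hij.symm
  rw [ih _ (hj.sum_levels_lt hf) (hj.swapLetters h hij') (hj.isWord hf) rfl,
    ih _ (h.sum_levels_lt hf) (h.swapLetters hj hij) (h.isWord hf) rfl,
    h.wordHeight_swapLetters_of_ne (by omega), hj.wordHeight_swapLetters_of_ne (by omega)]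
  have e : TemperleyLieb.swapLetters (TemperleyLieb.swapLetters f j) i =
      TemperleyLieb.swapLetters (TemperleyLieb.swapLetters f i) j := by
    rcases hij with h1 | h1
    · exact (swapLetters_comm h1).symm
    · exact swapLetters_comm h1
  rw [e]
  simp only [map_sub, map_smul, smul_sub]
  rw [genOp_comm q hij, smul_comm]
  abel

theorem genOp_baseVec_peak {f : ℕ → Bool} (hf : IsWord n f) {i : ℕ} (h1 : f i = true)
    (h2 : f (i + 1) = false) : genOp q n i (baseVec n f) = (q : ℂ) • baseVec n f := by
  obtain ⟨a, rfl⟩ := HalfDiagram.exists_word_eq hf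
  obtain ⟨hi, h⟩ := HalfDiagram.hasArch_of_word h1 h2
  rw [baseVec_word, genOp_eq q hi, HalfDiagram.joinOp_xi, a.join_of_arch hi h,
    HalfDiagram.weight, joinWeight, if_pos h]

theorem eq_true_of_not_isPeak {f : ℕ → Bool} (hf : IsWord n f) (hp : ∀ i, ¬ IsPeak f i) {k : ℕ}
    (hk : 2 ≤ wordHeight f k) (j : ℕ) : f (k + j) = true ∧ 2 ≤ wordHeight f (k + j) := by
  have key : ∀ j, 2 ≤ wordHeight f j → f j = true := by
    intro j hj
    by_contra h
    have h' : f j = false := by simpa using h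
    have := (levels_eq_one_iff hf).2 hp _ (hf.mem_levels h')
    omega
  induction j with
  | zero => exact ⟨key k hk, hk⟩
  | succ j ih =>
    have : 2 ≤ wordHeight f (k + (j + 1)) := by
      rw [← add_assoc, wordHeight_succ_of_true ih.1]
      omega
    exact ⟨key _ this, this⟩

/-- A word without peaks is `()()⋯()` followed by opening brackets. Equal neighbouring letters thus
belong to two through-strings, which the generator would join. -/
theorem genOp_baseVec_slope {f : ℕ → Bool} (hf : IsWord n f) (hp : ∀ i, ¬ IsPeak f i) {i : ℕ}
    (h : f i = f (i + 1)) : genOp q n i (baseVec n f) = 0 := by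
  by_cases hi : i + 1 < n
  swap
  · simp [genOp, hi]
  have hall := levels_eq_one_iff hf |>.2 hp
  cases h1 : f i with
  | false =>
    exfalso
    have h2 := hall _ (hf.mem_levels h1)
    have h3 := hf.one_le _ (h ▸ h1)
    rw [wordHeight_succ_of_false h1] at h3
    omega
  | true =>
    have h2 : f (i + 1) = true := h ▸ h1
    have hge : ∀ j, i + 2 ≤ j → f j = true := by
      intro j hj
      obtain ⟨l, rfl⟩ := Nat.exists_eq_add_of_le hj
      refine (eq_true_of_not_isPeak hf hp ?_ l).1
      rw [wordHeight_succ_of_true (k := i + 1) h2, wordHeight_succ_of_true h1]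
      omega
    obtain ⟨a, rfl⟩ := HalfDiagram.exists_word_eq hf
    have hthrough : ∀ k : Fin n, i ≤ k.1 → a.partner k = k := by
      intro k hk
      by_contra hne
      have hcl : ∀ k : Fin n, i ≤ k.1 → ¬ a.partner k < k := by
        intro k hk
        refine HalfDiagram.word_eq_true.1 ?_ k.2
        rcases Nat.lt_or_ge k.1 (i + 2) with h3 | h3
        · have : k.1 = i ∨ k.1 = i + 1 := by omega
          rcases this with e | e <;> rw [e] <;> assumption
        · exact hge _ h3
      have h4 := lt_of_le_of_ne (not_lt.1 (hcl k hk)) (Ne.symm hne)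
      have h5 := hcl (a.partner k) (hk.trans h4.le)
      rw [a.partner_partner] at h5
      exact h5 h4
    have e1 := hthrough ⟨i, by omega⟩ le_rfl
    have e2 := hthrough ⟨i + 1, hi⟩ (Nat.le_succ i)
    rw [baseVec_word, genOp_eq q hi, HalfDiagram.joinOp_xi, HalfDiagram.weight, joinWeight,
      if_neg (by rw [e1]; simp), if_pos ⟨e1, e2⟩]
    simp

/-- A maximum starting at height zero does not come from a box. All boxes lie at distance at least
two from it, and their operators commute with the generator there. -/
theorem genOp_wordVec_of_wordHeight_eq_zero {f : ℕ → Bool} (hf : IsWord n f) {i : ℕ}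
    (h1 : f i = true) (h2 : f (i + 1) = false) (h3 : wordHeight f i = 0) :
    genOp q n i (wordVec q n f) = (q : ℂ) • wordVec q n f := by
  induction hs : (levels n f).sum using Nat.strong_induction_on generalizing f with
    | _ s ih => ?_
  subst hs
  by_cases hp : ∃ j, IsPeak f j
  · obtain ⟨j, hj⟩ := hp
    have hij : j + 2 ≤ i ∨ i + 2 ≤ j := by
      obtain ⟨g1, g2, g3⟩ := hj
      by_cases e1 : j = i
      · subst e1; omega
      by_cases e2 : j = i + 1
      · subst e2; simp_all
      by_cases e3 : i = j + 1
      · subst e3; simp_all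
      omega
    have := ih _ (hj.sum_levels_lt hf) (hj.isWord hf)
      (by rw [swapLetters_of_ne (by omega) (by omega), h1])
      (by rw [swapLetters_of_ne (by omega) (by omega), h2])
      (by rw [hj.wordHeight_swapLetters_of_ne (by omega), h3]) rfl
    rw [hj.wordVec hf, map_sub, map_smul, genOp_comm q hij.symm, this]
    simp only [map_smul, smul_sub]
    rw [smul_comm]
  · rw [not_exists] at hp
    rw [wordVec_of_not_isPeak hp, genOp_baseVec_peak hf h1 h2]

/-- The recursion for `mu` holds up to the levels of the word. -/
def GoodLevels (q : ℝ) (n : ℕ) (f : ℕ → Bool) : Prop :=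
  ∀ x ∈ levels n f, ∀ k < x, mu q (k + 1) * (q - mu q k) = 1

theorem IsPeak.goodLevels {f : ℕ → Bool} {i : ℕ} (h : IsPeak f i) (hf : IsWord n f)
    (hg : GoodLevels q n f) : GoodLevels q n (TemperleyLieb.swapLetters f i) := by
  obtain ⟨R, h1, h2, -⟩ := h.levels hf
  intro x hx k hk
  rw [h2, Multiset.mem_cons] at hx
  rcases hx with rfl | hx
  · exact hg _ (h1 ▸ Multiset.mem_cons_self _ _) k (by omega)
  · exact hg _ (h1 ▸ Multiset.mem_cons_of_mem hx) k hk

theorem IsPeak.goodLevels_moveToFront {f : ℕ → Bool} {i : ℕ} (h : IsPeak f i) (hf : IsWord n f)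
    (hg : GoodLevels q n f) :
    GoodLevels q n (moveToFront (TemperleyLieb.swapLetters f i) i) := by
  obtain ⟨R, h1, -, h2⟩ := h.levels hf
  intro x hx k hk
  rw [h2, Multiset.mem_cons] at hx
  rcases hx with rfl | hx
  · exact hg _ (h1 ▸ Multiset.mem_cons_self _ _) k (by omega)
  · exact hg _ (h1 ▸ Multiset.mem_cons_of_mem hx) k hk

theorem mu_zero (q : ℝ) : mu q 0 = 0 := rfl

/-- The vectors of the second basis are annihilated at slopes. -/
theorem genOp_wordVec_slope {f : ℕ → Bool} (hf : IsWord n f)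
    (hg : GoodLevels q n f) {i : ℕ} (hi : i + 1 < n) (h : f i = f (i + 1)) :
    genOp q n i (wordVec q n f) = 0 := by
  induction hs : (levels n f).sum using Nat.strong_induction_on generalizing f i with
    | _ s ih => ?_
  subst hs
  by_cases hp : ∃ j, IsPeak f j
  swap
  · rw [not_exists] at hp
    rw [wordVec_of_not_isPeak hp, genOp_baseVec_slope hf hp h]
  obtain ⟨j, hj⟩ := hp
  have hj' := hj
  obtain ⟨g1, g2, g3⟩ := hj'
  have hf' := hj.isWord hf
  have hg' := hj.goodLevels hf hg
  have hlt := hj.sum_levels_lt hf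
  have hne : j ≠ i := by rintro rfl; simp_all
  -- after removing the box at `j`, there is a peak at `i`, next to `j`
  have key : (i + 1 = j ∨ j + 1 = i) → swapLetters f j i = true →
      swapLetters f j (i + 1) = false →
      wordHeight (swapLetters f j) i + 1 = wordHeight f j →
      swapLetters (swapLetters f j) i j = swapLetters (swapLetters f j) i (j + 1) →
      (∀ v, genOp q n i (genOp q n j (genOp q n i v)) = genOp q n i v) →
      genOp q n i (wordVec q n f) = 0 := by
    intro hij k1 k2 k3 k4 k5
    have hjn : j + 1 < n := hf.lt g2
    have hmu := hg _ (hf.mem_levels g2) (wordHeight (swapLetters f j) i)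
      (by rw [wordHeight_succ_of_true g1]; omega)
    rw [k3] at hmu
    have hmu' : ((mu q (wordHeight f j) : ℝ) : ℂ) *
        ((q : ℂ) - ((mu q (wordHeight (swapLetters f j) i) : ℝ) : ℂ)) = 1 := by
      exact_mod_cast hmu
    rw [hj.wordVec hf]
    rcases Nat.eq_zero_or_pos (wordHeight (swapLetters f j) i) with h0 | h0
    · have e := genOp_wordVec_of_wordHeight_eq_zero (q := q) hf' k1 k2 h0
      rw [h0, mu_zero, Complex.ofReal_zero, sub_zero] at hmu'
      set v := wordVec q n (swapLetters f j)
      -- Here `μ_1 = 1/q`, and `v` is a `q`-eigenvector of `genOp q n i`. Writing `v` as a multiple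
      -- of its image brings the relation `e_i e_j e_i = e_i` into play.
      have e2 : v = ((mu q (wordHeight f j) : ℝ) : ℂ) • genOp q n i v := by
        rw [e, smul_smul, hmu', one_smul]
      rw [map_sub, map_smul]
      conv_lhs => enter [1]; rw [e2]
      rw [map_smul, map_smul, k5, sub_self]
    · have hpk : IsPeak (swapLetters f j) i := ⟨k1, k2, h0⟩
      have e := ih _ ((hpk.sum_levels_lt hf').trans hlt) (hpk.isWord hf') (hpk.goodLevels hf' hg')
        hjn k4 rfl
      rw [hpk.wordVec hf']
      set v := wordVec q n (swapLetters (swapLetters f j) i)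
      -- With `e_j v = 0`, `μ = μ_k` and `μ' = μ_{k+1}`, the product `e_i (e_j - μ')(e_i - μ) v`
      -- becomes `(1 - μ'(q - μ)) e_i v`, which vanishes by the recursion.
      simp only [map_sub, map_smul, smul_sub, e, smul_zero, sub_zero, k5, genOp_sq]
      rw [smul_smul, smul_smul, ← sub_smul, ← mul_sub, hmu', one_smul, sub_self]
  by_cases e1 : j = i + 1
  · subst e1
    refine key (Or.inl rfl) ?_ ?_ ?_ ?_ ?_
    · rw [swapLetters_of_ne (by omega) (by omega), h, g1]
    · rw [swapLetters_left, g2]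
    · rw [wordHeight_swapLetters_of_le (by omega), wordHeight_succ_of_true (h.trans g1)]
    · rw [swapLetters_right, swapLetters_of_ne (by omega) (by omega),
        swapLetters_of_ne (by omega) (by omega), swapLetters_right, h]
    · exact genOp_up q (hf.lt g2)
  by_cases e2 : i = j + 1
  · subst e2
    have a1 : swapLetters f j (j + 1) = true := swapLetters_right.trans g1
    have a2 : swapLetters f j (j + 1 + 1) = false := by
      rw [swapLetters_of_ne (by omega) (by omega), ← h, g2]
    refine key (Or.inr rfl) a1 a2 ?_ ?_ ?_
    · rw [hj.wordHeight_swapLetters_succ]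
      omega
    · rw [swapLetters_left, a2, swapLetters_of_ne (by omega) (by omega), swapLetters_left, g2]
    · exact genOp_down q hi
  · rw [hj.wordVec hf, map_sub, map_smul, genOp_comm q (by omega),
      ih _ hlt hf' hg' hi (by
        rw [swapLetters_of_ne (by omega) (by omega), swapLetters_of_ne (by omega) (by omega), h])
        rfl]
    simp

end WordVec

/-! ### Contraction at a minimum, and the norm formula -/

section Valleys

variable {n : ℕ} {q : ℝ} {f : ℕ → Bool} {i j : ℕ}

/-- In a word without peaks, brackets alternate up to the last minimum. -/
theorem wordHeight_of_not_isPeak (hf : IsWord n f) (hp : ∀ i, ¬ IsPeak f i) (h1 : f i = false)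
    {k : ℕ} (hk : k ≤ i) :
    (f k = true ∧ wordHeight f k = 0) ∨ (f k = false ∧ wordHeight f k = 1) := by
  have hi := (levels_eq_one_iff hf).2 hp _ (hf.mem_levels h1)
  cases hfk : f k with
  | false => exact Or.inr ⟨rfl, (levels_eq_one_iff hf).2 hp _ (hf.mem_levels hfk)⟩
  | true =>
    refine Or.inl ⟨rfl, ?_⟩
    by_contra h0
    have hne : k ≠ i := by rintro rfl; simp_all
    have := (eq_true_of_not_isPeak hf hp (k := k + 1)
      (by rw [wordHeight_succ_of_true hfk]; omega) (i - (k + 1))).1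
    rw [show k + 1 + (i - (k + 1)) = i by omega, h1] at this
    exact absurd this (by simp)

theorem wordHeight_eq_mod_two (hf : IsWord n f) (hp : ∀ i, ¬ IsPeak f i) (h1 : f i = false)
    {k : ℕ} (hk : k ≤ i) : wordHeight f k = k % 2 := by
  induction k with
  | zero => rfl
  | succ k ih =>
    have ih := ih (by omega)
    rcases wordHeight_of_not_isPeak hf hp h1 (k := k) (by omega) with ⟨h2, h3⟩ | ⟨h2, h3⟩
    · rw [wordHeight_succ_of_true h2]; omega
    · rw [wordHeight_succ_of_false h2]; omega

theorem eq_decide_of_not_isPeak (hf : IsWord n f) (hp : ∀ i, ¬ IsPeak f i) (h1 : f i = false)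
    {k : ℕ} (hk : k ≤ i) : f k = decide (k % 2 = 0) := by
  have := wordHeight_eq_mod_two hf hp h1 hk
  rcases wordHeight_of_not_isPeak hf hp h1 hk with ⟨h2, h3⟩ | ⟨h2, h3⟩ <;> rw [h2] <;> simp <;>
    omega

/-- The word alternates up to the minimum, so cutting out `)(` and prefixing `()` reproduces it. -/
theorem moveToFront_of_not_isPeak (hf : IsWord n f) (hp : ∀ i, ¬ IsPeak f i) (h1 : f i = false)
    (h2 : f (i + 1) = true) : moveToFront f i = f := by
  have key := fun k hk => eq_decide_of_not_isPeak hf hp h1 (k := k) hk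
  have hi := key i le_rfl
  rw [h1] at hi
  have hi' : i % 2 ≠ 0 := by simpa using hi.symm
  ext j
  simp only [moveToFront]
  split_ifs with e1 e2 e3
  · rw [key j (by omega)]; simp [e1]
  · rw [key j (by omega)]; simp [e2]
  · rcases Nat.lt_or_ge i j with h | h
    · rw [show j = i + 1 by omega, h2, key _ (by omega)]
      simp
      omega
    · rw [key _ h, key _ (by omega)]
      congr 1
      rw [eq_iff_iff]
      omega
  · rfl

theorem genProd_baseVec (hq : q ≠ 0) (hf : IsWord n f) (hp : ∀ i, ¬ IsPeak f i)
    (h1 : f i = false) (h2 : f (i + 1) = true) (hi : i + 1 < n) :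
    genProd q n (i + 1) (baseVec n f) = baseVec n f := by
  induction i using Nat.strong_induction_on with | _ i ih => ?_
  have key := fun k hk => eq_decide_of_not_isPeak hf hp h1 (k := k) hk
  have hi0 := key i le_rfl
  rw [h1] at hi0
  have hi' : i % 2 ≠ 0 := by simpa using hi0.symm
  obtain ⟨m, rfl⟩ := Nat.exists_eq_succ_of_ne_zero (show i ≠ 0 by omega)
  rw [Nat.succ_eq_add_one] at *
  have hm : f m = true := by
    rw [key m (by omega)]
    simp
    omega
  have e1 := genOp_baseVec_peak (q := q) hf hm h1
  have e2 := genOp_up q (i := m) (by omega) (baseVec n f)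
  rw [e1, map_smul, map_smul] at e2
  -- Cancelling `q` from `e_m e_{m+1} e_m ξ = e_m ξ`, where `e_m ξ = q ξ`, shows that the last two
  -- factors of the product fix `ξ`. The product therefore shortens by two.
  have e3 := smul_right_injective _ (Complex.ofReal_ne_zero.2 hq) e2
  rw [genProd_succ, genProd_succ, e3]
  match m with
  | 0 => rfl
  | l + 1 =>
    refine ih l (by omega) ?_ hm (by omega)
    rw [key l (by omega)]
    simp
    omega

theorem moveToFront_swapLetters_of_ge (h : i + 2 ≤ j) :
    moveToFront (swapLetters f j) i = swapLetters (moveToFront f i) j := by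
  ext k
  simp only [moveToFront, swapLetters]
  grind

theorem moveToFront_swapLetters_of_le (h : j + 2 ≤ i) :
    moveToFront (swapLetters f j) i = swapLetters (moveToFront f i) (j + 2) := by
  ext k
  simp only [moveToFront, swapLetters]
  grind

theorem moveToFront_swapLetters_succ (h : f i = f (i + 2)) :
    moveToFront (swapLetters f (i + 1)) (i + 1) = moveToFront f i := by
  ext k
  simp only [moveToFront, swapLetters]
  grind

theorem moveToFront_swapLetters_pred (h : f i = f (i + 2)) :
    moveToFront (swapLetters f i) i = moveToFront f (i + 1) := by
  ext k
  simp only [moveToFront, swapLetters]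
  grind

/-- Contracting the vector of a word at a minimum gives the vector of the word with the minimum
removed (and an arch put in front). -/
theorem genProd_wordVec_valley (hq : q ≠ 0) (hf : IsWord n f) (hg : GoodLevels q n f)
    (h1 : f i = false) (h2 : f (i + 1) = true) (hi : i + 1 < n) :
    genProd q n (i + 1) (wordVec q n f) = wordVec q n (moveToFront f i) := by
  induction hs : (levels n f).sum using Nat.strong_induction_on generalizing f i with
    | _ s ih => ?_
  subst hs
  by_cases hp : ∃ j, IsPeak f j
  swap
  · rw [not_exists] at hp
    rw [moveToFront_of_not_isPeak hf hp h1 h2, wordVec_of_not_isPeak hp,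
      genProd_baseVec hq hf hp h1 h2 hi]
  obtain ⟨j, hj⟩ := hp
  have hj' := hj
  obtain ⟨g1, g2, g3⟩ := hj'
  have hf' := hj.isWord hf
  have hg' := hj.goodLevels hf hg
  have hlt := hj.sum_levels_lt hf
  have hne : j ≠ i := by rintro rfl; simp_all
  have hfm := hf.moveToFront h1 h2 hi
  by_cases e1 : j = i + 1
  · subst e1
    have a1 : swapLetters f (i + 1) i = false := by rw [swapLetters_of_ne (by omega) (by omega), h1]
    have a2 : swapLetters f (i + 1) (i + 1) = false := swapLetters_left.trans g2
    have a3 : swapLetters f (i + 1) (i + 1 + 1) = true := swapLetters_right.trans g1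
    -- Without the box there is a slope at `i`, which kills the `μ`-term. The remaining term is the
    -- contraction at the minimum `i+1`, with one more factor in the product.
    have e := genOp_wordVec_slope hf' hg' hi (a1.trans a2.symm)
    have e' := ih _ hlt hf' hg' a2 a3 (hf.lt g2) rfl
    rw [moveToFront_swapLetters_succ (h1.trans g2.symm), genProd_succ] at e'
    rw [hj.wordVec hf, map_sub, map_smul, e', genProd_succ, e]
    simp
  by_cases e2 : i = j + 1
  · subst e2
    have a1 : swapLetters f j j = false := swapLetters_left.trans g2
    have a2 : swapLetters f j (j + 1) = true := swapLetters_right.trans g1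
    have a3 : swapLetters f j (j + 1 + 1) = true := by
      rw [swapLetters_of_ne (by omega) (by omega), h2]
    -- Mirror case: the slope at `j+1` kills the `μ`-term, and `e_j e_{j+1} e_j = e_j` shortens the
    -- product to the contraction at the minimum `j`.
    have e := genOp_wordVec_slope hf' hg' hi (a2.trans a3.symm)
    have e' := ih _ hlt hf' hg' a1 a2 (by omega) rfl
    rw [moveToFront_swapLetters_pred (g1.trans h2.symm)] at e'
    rw [hj.wordVec hf, map_sub, map_smul, genProd_genOp_pred q hi, e', genProd_succ q (j + 1), e]
    simp
  rcases Nat.lt_or_ge i j with h | h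
  · have hij : i + 2 ≤ j := by omega
    have hH : wordHeight (moveToFront f i) j = wordHeight f j :=
      wordHeight_moveToFront_of_ge h1 h2 (hf.one_le i h1) hij
    have hm : ∀ k, i + 2 ≤ k → moveToFront f i k = f k := by
      intro k hk
      simp only [moveToFront]
      grind
    have hpk : IsPeak (moveToFront f i) j :=
      ⟨by rw [hm j hij, g1], by rw [hm _ (by omega), g2], hH ▸ g3⟩
    have e := ih _ hlt hf' hg' (i := i) (by rw [swapLetters_of_ne (by omega) (by omega), h1])
      (by rw [swapLetters_of_ne (by omega) (by omega), h2]) hi rfl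
    rw [moveToFront_swapLetters_of_ge hij] at e
    rw [hj.wordVec hf, hpk.wordVec hfm, hH, map_sub, map_smul, ← genOp_genProd q (by omega), e]
  · have hij : j + 2 ≤ i := by omega
    have hH : wordHeight (moveToFront f i) (j + 2) = wordHeight f j :=
      wordHeight_moveToFront_of_le (by omega)
    have hm : ∀ k < i, moveToFront f i (k + 2) = f k := by
      intro k hk
      simp only [moveToFront]
      grind
    have hpk : IsPeak (moveToFront f i) (j + 2) :=
      ⟨by rw [hm j (by omega), g1], (hm (j + 1) (by omega)).trans g2, hH ▸ g3⟩
    have e := ih _ hlt hf' hg' (i := i) (by rw [swapLetters_of_ne (by omega) (by omega), h1])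
      (by rw [swapLetters_of_ne (by omega) (by omega), h2]) hi rfl
    rw [moveToFront_swapLetters_of_le hij] at e
    rw [hj.wordVec hf, hpk.wordVec hfm, hH, map_sub, map_smul, genProd_genOp q hij hi, e]

theorem card_levels_word (a : HalfDiagram n) :
    (levels n a.word).card = Nat.card {j : Fin n // a.IsClosing j} := by
  classical
  rw [Nat.card_eq_fintype_card, Fintype.card_subtype, Finset.card_filter, levels,
    Multiset.card_sum, Finset.sum_range]
  refine Finset.sum_congr rfl fun j _ => ?_
  have : a.word j.1 = false ↔ a.IsClosing j := by simp [HalfDiagram.word_eq_false]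
  by_cases h : a.IsClosing j
  · simp [h, this.2 h]
  · have h' : a.word j.1 = true := by simpa using mt this.1 h
    simp [h, h']

theorem formMap_wordVec_self (hq : q ≠ 0) (hf : IsWord n f) (hg : GoodLevels q n f) :
    formMap q (wordVec q n f) (wordVec q n f) =
      ((((levels n f).map fun x => 1 / mu q x).prod : ℝ) : ℂ) := by
  induction hs : (levels n f).sum using Nat.strong_induction_on generalizing f with
    | _ s ih => ?_
  subst hs
  by_cases hp : ∃ i, IsPeak f i
  · obtain ⟨i, hi⟩ := hp
    obtain ⟨R, r1, r2, r3⟩ := hi.levels hf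
    have hlt := hi.sum_levels_lt hf
    have hf' := hi.isWord hf
    have hg' := hi.goodLevels hf hg
    have b1 : swapLetters f i i = false := swapLetters_left.trans hi.2.1
    have b2 : swapLetters f i (i + 1) = true := swapLetters_right.trans hi.1
    have hin : i + 1 < n := hf.lt hi.2.1
    have ih1 := ih _ hlt hf' hg' rfl
    -- Induction also covers the contracted word: its level `1` replaces the level `wordHeight f i +
    -- 1`, which is at least `2`.
    have ih2 := ih _ (by rw [r1, r3, Multiset.sum_cons, Multiset.sum_cons]; have := hi.2.2; omega)
      (hf'.moveToFront b1 b2 hin) (hi.goodLevels_moveToFront hf hg) rfl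
    rw [← genProd_wordVec_valley hq hf' hg' b1 b2 hin, formMap_genProd_self hq hin, r3,
      Multiset.map_cons, Multiset.prod_cons] at ih2
    rw [r2, Multiset.map_cons, Multiset.prod_cons] at ih1
    have hmem : wordHeight f i + 1 ∈ levels n f := r1 ▸ Multiset.mem_cons_self _ _
    have m1 := hg _ hmem 0 (by omega)
    have m2 := hg _ hmem (wordHeight f i) (by omega)
    -- The recursion one index lower exhibits this `μ` as a factor of `1`.
    have m3 : mu q (wordHeight f i) ≠ 0 := by
      have := hg _ hmem (wordHeight f i - 1) (by omega)
      rw [Nat.sub_add_cancel hi.2.2] at this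
      exact left_ne_zero_of_mul (by rw [this]; exact one_ne_zero)
    rw [zero_add, mu_zero, sub_zero] at m1
    rw [r1, Multiset.map_cons, Multiset.prod_cons, hi.wordVec hf]
    have hmu1 : 1 / mu q 1 = q := by
      rw [one_div]
      exact inv_eq_of_mul_eq_one_right m1
    have hmu2 : 1 / mu q (wordHeight f i + 1) = q - mu q (wordHeight f i) := by
      rw [one_div]
      exact inv_eq_of_mul_eq_one_right m2
    rw [hmu1] at ih2
    rw [hmu2]
    set v := wordVec q n (swapLetters f i)
    set P := (Multiset.map (fun x => 1 / mu q x) R).prod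
    set m := mu q (wordHeight f i)
    have hqC : (q : ℂ) ≠ 0 := Complex.ofReal_ne_zero.2 hq
    have hmC : (m : ℂ) ≠ 0 := Complex.ofReal_ne_zero.2 m3
    -- The norm of the contracted vector is `q P`, the factor `q = 1/μ_1` coming from the arch in
    -- front; it is also `q` times this value of the form.
    have k1 : formMap q (genOp q n i v) v = (P : ℂ) := by
      refine mul_left_cancel₀ hqC ?_
      rw [ih2]
      push_cast
      rfl
    have k2 := formMap_genOp_self hq i v
    have k3 : formMap q v (genOp q n i v) = (P : ℂ) := by rw [← formMap_genOp hq, k1]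
    simp only [map_sub, LinearMap.sub_apply, map_smul, LinearMap.smul_apply, map_smulₛₗ,
      smul_eq_mul, Complex.conj_ofReal, k1, k2, k3, ih1]
    push_cast
    -- What remains is `q P - 2 m P + m² (P / m) = (q - m) P`.
    field_simp
    ring
  · rw [not_exists] at hp
    obtain ⟨a, rfl⟩ := HalfDiagram.exists_word_eq hf
    rw [wordVec_of_not_isPeak hp, baseVec_word, formMap_xi, formBasis_self, ← card_levels_word]
    congr 1
    -- A minimal diagram has norm `q` to the number of arches, and every level contributes `1/μ_1 =
    -- q`.
    have hone := (levels_eq_one_iff hf).2 hp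
    rw [Multiset.eq_replicate_card.2 hone, Multiset.map_replicate, Multiset.prod_replicate,
      Multiset.card_replicate]
    rcases Nat.eq_zero_or_pos (levels n a.word).card with h0 | h0
    · rw [h0, pow_zero, pow_zero]
    · obtain ⟨x, hx⟩ := Multiset.card_pos_iff_exists_mem.1 h0
      have m1 := hg x hx 0 (by rw [hone x hx]; omega)
      rw [zero_add, mu_zero, sub_zero] at m1
      rw [one_div, inv_eq_of_mul_eq_one_right m1]

end Valleys

/-! ### Chebyshev polynomials -/

theorem Delta_zero (q : ℝ) : Delta 0 q = 1 := by simp [Delta]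

theorem Delta_one (q : ℝ) : Delta 1 q = q := by simp [Delta]

/-- Expansion along the first row, and of the second minor along its first column. -/
theorem Delta_add_two (k : ℕ) (q : ℝ) :
    Delta (k + 2) q = q * Delta (k + 1) q - Delta k q := by
  rw [Delta, Matrix.det_succ_row_zero, Fin.sum_univ_succ, Fin.sum_univ_succ,
    Finset.sum_eq_zero fun j _ => by simp [Fin.ext_iff], add_zero]
  have e1 : (Matrix.of fun i j : Fin (k + 2) => if i = j then q else
      if i.1 + 1 = j.1 ∨ j.1 + 1 = i.1 then (1 : ℝ) else 0).submatrix Fin.succ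
        (Fin.succAbove 0) = Matrix.of fun i j : Fin (k + 1) => if i = j then q else
      if i.1 + 1 = j.1 ∨ j.1 + 1 = i.1 then 1 else 0 := by
    ext i j
    simp
  have e2 : ((Matrix.of fun i j : Fin (k + 2) => if i = j then q else
      if i.1 + 1 = j.1 ∨ j.1 + 1 = i.1 then (1 : ℝ) else 0).submatrix Fin.succ
        (Fin.succAbove (Fin.succ 0))).det = Delta k q := by
    rw [Matrix.det_succ_column_zero, Fin.sum_univ_succ,
      Finset.sum_eq_zero fun j _ => by simp [Fin.ext_iff, Fin.succAbove], add_zero]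
    have e3 : ((Matrix.of fun i j : Fin (k + 2) => if i = j then q else
        if i.1 + 1 = j.1 ∨ j.1 + 1 = i.1 then (1 : ℝ) else 0).submatrix Fin.succ
          (Fin.succAbove (Fin.succ 0))).submatrix (Fin.succAbove 0) Fin.succ =
        Matrix.of fun i j : Fin k => if i = j then q else
          if i.1 + 1 = j.1 ∨ j.1 + 1 = i.1 then 1 else 0 := by
      ext i j
      simp [Fin.ext_iff, Fin.succAbove]
    rw [e3, Delta]
    simp [Fin.ext_iff, Fin.succAbove]
  rw [e1, e2]
  simp [Delta]
  ring

/-- The three-term recursion for `Δ`, divided by `Δ_{k+1}`. The nonvanishing hypothesis of the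
theorem enters only through this identity; well-definedness does not use it. -/
theorem mu_recursion {q : ℝ} (hq : q ≠ 0) {x : ℕ}
    (h : ∀ k : ℕ, 1 ≤ k → k ≤ x → Delta k q ≠ 0) {k : ℕ} (hk : k < x) :
    mu q (k + 1) * (q - mu q k) = 1 := by
  match k with
  | 0 =>
    rw [mu_zero, zero_add, mu, Delta_zero, zero_add, Delta_one, sub_zero, one_div,
      inv_mul_cancel₀ hq]
  | k + 1 =>
    have h1 := h (k + 1) (by omega) (by omega)
    have h2 := h (k + 2) (by omega) (by omega)
    rw [mu, mu, show k + 1 + 1 = k + 2 from rfl]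
    field_simp
    rw [Delta_add_two]
    ring

/-! ### The theorem -/

theorem eq_wordVec_of_secondBasis {n : ℕ} {q : ℝ} {a : HalfDiagram n} {v : U n}
    (h : SecondBasis q a v) : v = wordVec q n a.word := by
  induction h with
  | minimal a ha => rw [wordVec_of_not_isPeak (a.isMinimal_iff.1 ha), baseVec_word]
  | box i hi a b v hab hv ih =>
    obtain ⟨h1, h2⟩ := (HalfDiagram.isBoxAddition_iff hi).1 hab
    -- The minimum of `a` lies one below the height of `b` before its peak, so the index prescribed
    -- by the box addition is that height.
    have hh : a.height (i + 1) + 1 = wordHeight b.word i := by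
      rw [a.height_eq hi.le, h2, h1.wordHeight_swapLetters_succ]
      have := h1.2.2
      omega
    rw [h1.wordVec b.isWord_word, ← h2, ← ih, hh, genOp, dif_pos hi]

theorem secondBasis_wordVec {n : ℕ} (q : ℝ) (a : HalfDiagram n) :
    SecondBasis q a (wordVec q n a.word) := by
  induction hs : (levels n a.word).sum using Nat.strong_induction_on generalizing a with
    | _ s ih => ?_
  subst hs
  by_cases hp : ∃ i, IsPeak a.word i
  · obtain ⟨i, h1⟩ := hp
    have hi := a.isWord_word.lt h1.2.1
    obtain ⟨b, hb⟩ := HalfDiagram.exists_word_eq (h1.isWord a.isWord_word)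
    have h2 := ih _ (by rw [hb]; exact h1.sum_levels_lt a.isWord_word) b rfl
    have h3 := SecondBasis.box i hi b a _ ((HalfDiagram.isBoxAddition_iff hi).2 ⟨h1, hb⟩) h2
    rwa [← eq_wordVec_of_secondBasis h3]
  · rw [not_exists] at hp
    rw [wordVec_of_not_isPeak hp, baseVec_word]
    exact SecondBasis.minimal a (a.isMinimal_iff.2 hp)

end TemperleyLieb

theorem mainTheorem2 (n : ℕ) (q : ℝ) (hq : 0 < q) (a : TemperleyLieb.HalfDiagram n)
    (hΔ : ∀ x ∈ a.restrictedSequence, ∀ k : ℕ, 1 ≤ k → k ≤ x → TemperleyLieb.Delta k q ≠ 0) :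
    (∃! v : TemperleyLieb.U n, TemperleyLieb.SecondBasis q a v) ∧
      TemperleyLieb.form q (TemperleyLieb.xiPrime q a) (TemperleyLieb.xiPrime q a) =
        ((1 / (a.restrictedSequence.map (TemperleyLieb.mu q)).prod : ℝ) : ℂ) := by
  have hex := TemperleyLieb.secondBasis_wordVec q a
  refine ⟨⟨_, hex, fun v hv => TemperleyLieb.eq_wordVec_of_secondBasis hv⟩, ?_⟩
  have hxi : TemperleyLieb.xiPrime q a = TemperleyLieb.wordVec q n a.word :=
    TemperleyLieb.eq_wordVec_of_secondBasis (Classical.epsilon_spec ⟨_, hex⟩)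
  have hg : TemperleyLieb.GoodLevels q n a.word := by
    intro x hx k hk
    rw [← a.coe_restrictedSequence, Multiset.mem_coe] at hx
    exact TemperleyLieb.mu_recursion hq.ne' (hΔ x hx) hk
  -- The product depends only on the multiset of levels, so the order of the restricted sequence is
  -- immaterial.
  rw [hxi, ← TemperleyLieb.formMap_apply,
    TemperleyLieb.formMap_wordVec_self hq.ne' a.isWord_word hg, ← a.coe_restrictedSequence,
    Multiset.map_coe, Multiset.prod_coe, one_div, List.prod_inv, List.map_map]
  congr 3
  ext x
  simp
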